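/- **Theorem 8.2 (The Geometric Restriction Theorem).** Let $Z$ be a smooth Riemannian manifold and let $G(p,TZ)\to Z$ be the bundle of tangent $p$-planes of $Z$. Let $\mathbf{G}\subset G(p,TZ)$ be a closed subset that admits a smooth neighborhood retraction preserving the fibres of $G(p,TZ)\to Z$; that is, there are an open set $N\supset\mathbf{G}$ and a smooth map $\rho:N\to G(p,TZ)$ over the identity of $Z$ with $\rho(N)\subset\mathbf{G}$ and $\rho|_{\mathbf{G}}=\mathrm{id}$. An upper semi-continuous function $u:Z\to[-\infty,\infty)$ is called *$\mathbf{G}$-plurisubharmonic* if for every $z\in Z$, every function $\varphi$ which is $C^2$ near $z$ with $u\le\varphi$ near $z$ and $u(z)=\varphi(z)$, and every $\xi\in\mathbf{G}$ at $z$, $$\operatorname{trace}\{\operatorname{Hess}_z\varphi\,|_\xi\}\ \ge\ 0,$$ where $\operatorname{Hess}$ is the Riemannian Hessian. Let $X\subset Z$ be a (possibly only immersed) smooth submanifold of dimension $\ge p$ with the induced metric, let $\mathbf{G}(TX)=\{\xi\in\mathbf{G}:\xi\subset TX\}\subset G(p,TX)$, and let $B_{V,W}=(\nabla_V\widetilde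 W)^N$ be the second fundamental form of $X$. Suppose that $X$ is *$\mathbf{G}$-flat*, i.e. 1. ($\mathbf{G}$-regularity) each $\xi\in\mathbf{G}(TX)$ at a point $x\in X$ extends to a smooth field of planes belonging to $\mathbf{G}(TX)$ on a neighborhood of $x$ in $X$; and 2. $\operatorname{trace}\{B|_\xi\}=0$ for all $\xi\in\mathbf{G}(TX)$. Then for every $\mathbf{G}$-plurisubharmonic function $u$ on $Z$, the restriction $u|_X$ is $\mathbf{G}(TX)$-plurisubharmonic on $X$: it is an upper semi-continuous function with values in $[-\infty,\infty)$, and for every $x\in X$, every function $\varphi$ on $X$ which is $C^2$ near $x$ with $u|_X\le\varphi$ near $x$ and $u(x)=\varphi(x)$, and every $\xi\in\mathbf{G}(TX)$ at $x$, one has $\operatorname{trace}\{(\operatorname{Hess}_X\varphi)_x|_\xi\}\ge 0$, where $\operatorname{Hess}_X$ is the Riemannian Hessian of the induced metric on $X$. -/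

import Mathlib

open Bundle Manifold Module Topology
open scoped Manifold ContDiff

noncomputable section

namespace GeometricRestriction

variable {E : Type*} [NormedAddCommGroup E] [NormedSpace ℝ E]
  {Z : Type*} [TopologicalSpace Z] [ChartedSpace E Z]
  {F : Type*} [NormedAddCommGroup F] [NormedSpace ℝ F]
  {X : Type*} [TopologicalSpace X] [ChartedSpace F X]

/-! ### Metrics, Christoffel symbols, Hessian, second fundamental form -/

variable (E Z) in
/-- A field of bilinear forms on the tangent spaces of `Z`. The Riemannian metrics below are
of this kind: the given metric of the ambient manifold, and the metric induced on a submanifold. -/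
abbrev BilinearField : Type _ :=
  ∀ z : Z, TangentSpace 𝓘(ℝ, E) z →L[ℝ] TangentSpace 𝓘(ℝ, E) z →L[ℝ] ℝ

/-- The differential of `f : X → Z` at `x`. -/
abbrev differential (f : X → Z) (x : X) :
    TangentSpace 𝓘(ℝ, F) x →L[ℝ] TangentSpace 𝓘(ℝ, E) (f x) :=
  mfderiv 𝓘(ℝ, F) 𝓘(ℝ, E) f x

/-- The pull-back `f^* g`, that is, `(f^* g)_x(v, w) = g_{f x}(df v, df w)`. If `f` is the inclusion
of a submanifold and `g` a Riemannian metric, this is the induced Riemannian metric. -/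
def pullbackMetric (f : X → Z) (g : BilinearField E Z) : BilinearField F X := fun x =>
  ContinuousLinearMap.bilinearComp (E := E) (F := E) (E' := F) (F' := F)
    (g (f x)) (differential f x) (differential f x)

/-- The expression, in the preferred chart `ψ` around `z`, of a field of bilinear forms on `Z`:
at the point `y` of the model space it is `(v, w) ↦ g(d(ψ⁻¹)_y v, d(ψ⁻¹)_y w)`. -/
def coordMetric (g : BilinearField E Z) (z : Z) (y : E) : E →L[ℝ] E →L[ℝ] ℝ :=
  pullbackMetric (F := E) (X := E) (extChartAt 𝓘(ℝ, E) z).symm g y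

/-- The Christoffel symbols `Γ_y(v, w) = ∑ Γ^k_{ij} v^i w^j ∂_k` of a metric `h` on an open subset
of the model space: `Γ_y(v, w)` is the vector with
`2 h_y(Γ_y(v, w), a) = (∂_v h)(w, a) + (∂_w h)(v, a) - (∂_a h)(v, w)` for all `a`. -/
def christoffel (h : E → E →L[ℝ] E →L[ℝ] ℝ) (y v w : E) : E :=
  (h y).inverse ((1 / 2 : ℝ) •
    (fderiv ℝ h y v w + fderiv ℝ h y w v - ((fderiv ℝ h y).flip v).flip w))

/-- The Riemannian Hessian `Hess φ (v, w)` at `z`, computed in the preferred chart around `z` as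
`∂_v ∂_w φ - dφ(Γ(v, w))`. -/
def hessian (g : BilinearField E Z) (φ : Z → ℝ) (z : Z) (v w : TangentSpace 𝓘(ℝ, E) z) : ℝ :=
  let ψ := extChartAt 𝓘(ℝ, E) z
  let φ' : E → ℝ := φ ∘ ψ.symm
  let v' : E := differential (F := E) (E := E) (Z := E) ψ z v
  let w' : E := differential (F := E) (E := E) (Z := E) ψ z w
  fderiv ℝ (fderiv ℝ φ') (ψ z) v' w' -
    fderiv ℝ φ' (ψ z) (christoffel (coordMetric g z) (ψ z) v' w')

/-- The component of `a ∈ T_{f x} Z` tangent to the submanifold `f : X → Z`: it is `df(t)`, where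
`t ∈ T_x X` satisfies `g(df t, df s) = g(a, df s)` for all `s ∈ T_x X`. -/
def tangentialPart (g : BilinearField E Z) (f : X → Z) (x : X)
    (a : TangentSpace 𝓘(ℝ, E) (f x)) : TangentSpace 𝓘(ℝ, E) (f x) :=
  differential (F := F) f x
    ((pullbackMetric (F := F) f g x).inverse ((g (f x) a).comp (differential (F := F) f x)))

/-- The component of `a ∈ T_{f x} Z` normal to the submanifold `f : X → Z`. -/
def normalPart (g : BilinearField E Z) (f : X → Z) (x : X)
    (a : TangentSpace 𝓘(ℝ, E) (f x)) : TangentSpace 𝓘(ℝ, E) (f x) :=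
  a - tangentialPart (F := F) g f x a

/-- The covariant derivative `∇_v W̃`, for the Levi-Civita connection of `g` on `Z`, of the vector
field `W̃` tangent to the submanifold `f : X → Z` that extends `w ∈ T_x X` with constant
components in the preferred chart of `X` around `x`. If `c : F → E` is the expression of `f` in the
preferred charts, this field is `∂_w c`, and its covariant derivative is
`∂_v ∂_w c + Γ(∂_v c, ∂_w c)`. -/
def covDerivExtension (g : BilinearField E Z) (f : X → Z) (x : X)
    (v w : TangentSpace 𝓘(ℝ, F) x) : TangentSpace 𝓘(ℝ, E) (f x) :=
  let ψX := extChartAt 𝓘(ℝ, F) x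
  let ψZ := extChartAt 𝓘(ℝ, E) (f x)
  let c : F → E := ψZ ∘ f ∘ ψX.symm
  let v' : F := differential (F := F) (E := F) (Z := F) ψX x v
  let w' : F := differential (F := F) (E := F) (Z := F) ψX x w
  let a : E := fderiv ℝ (fderiv ℝ c) (ψX x) v' w' +
    christoffel (coordMetric g (f x)) (ψZ (f x))
      (fderiv ℝ c (ψX x) v') (fderiv ℝ c (ψX x) w')
  (mfderiv 𝓘(ℝ, E) 𝓘(ℝ, E) ψZ.symm (ψZ (f x)) : E →L[ℝ] E) a

/-- The second fundamental form `B_{v, w} = (∇_v W̃)^N` of the submanifold `f : X → Z`. -/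
def secondFundamentalForm (g : BilinearField E Z) (f : X → Z) (x : X)
    (v w : TangentSpace 𝓘(ℝ, F) x) : TangentSpace 𝓘(ℝ, E) (f x) :=
  normalPart (F := F) g f x (covDerivExtension (F := F) g f x v w)

/-! ### The Grassmann bundle of tangent `p`-planes -/

variable (E Z) in
/-- A tangent `p`-plane of `Z`, i.e. a point of the Grassmann bundle `G(p, TZ)`. -/
structure TangentPlane (p : ℕ) where
  /-- the foot point -/
  base : Z
  /-- the `p`-dimensional subspace of the tangent space -/
  plane : Submodule ℝ (TangentSpace 𝓘(ℝ, E) base)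
  finrank_eq : finrank ℝ plane = p

variable (E Z) in
/-- The vector bundle `Hom(ℝᵖ, TZ)`, i.e. the `p`-fold direct sum of `TZ`; its point `(z, A)`
is the `p`-tuple of tangent vectors `A e₁, …, A e_p` at `z`. -/
abbrev Tuples (p : ℕ) : Type _ :=
  TotalSpace (EuclideanSpace ℝ (Fin p) →L[ℝ] E)
    (fun z : Z => Bundle.Trivial Z (EuclideanSpace ℝ (Fin p)) z →L[ℝ] TangentSpace 𝓘(ℝ, E) z)

/-- A `p`-tuple of tangent vectors is a frame if it is linearly independent. -/
def IsFrame {p : ℕ} (A : Tuples E Z p) : Prop := Function.Injective A.2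

/-- The `p`-plane spanned by a frame. -/
def planeOf {p : ℕ} (A : {A : Tuples E Z p // IsFrame A}) : TangentPlane E Z p where
  base := A.1.1
  plane := LinearMap.range A.1.2.toLinearMap
  finrank_eq := by
    refine (LinearMap.finrank_range_of_inj (f := A.1.2.toLinearMap) A.2).trans ?_
    exact finrank_euclideanSpace_fin

/-- `A` is a frame of the `p`-plane `ξ`. -/
def IsFrameOf {p : ℕ} (A : Tuples E Z p) (ξ : TangentPlane E Z p) : Prop :=
  ∃ h : IsFrame A, planeOf ⟨A, h⟩ = ξ

variable [IsManifold 𝓘(ℝ, E) ∞ Z] [IsManifold 𝓘(ℝ, F) ∞ X]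

/-- The topology of `G(p, TZ)`: the quotient topology from the open set of frames in the
total space of `Hom(ℝᵖ, TZ)`. -/
instance {p : ℕ} : TopologicalSpace (TangentPlane E Z p) :=
  TopologicalSpace.coinduced (planeOf (E := E) (Z := Z) (p := p)) inferInstance

/-- A field `η` of tangent `p`-planes of `X` is smooth at `x` if it has a smooth frame near `x`. -/
def SmoothPlaneFieldAt {p : ℕ} (η : X → TangentPlane F X p) (x : X) : Prop :=
  ∃ A : X → Tuples F X p,
    ContMDiffAt 𝓘(ℝ, F) (𝓘(ℝ, F).prod 𝓘(ℝ, EuclideanSpace ℝ (Fin p) →L[ℝ] F)) ∞ A x ∧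
    ∀ᶠ x' in 𝓝 x, IsFrameOf (A x') (η x')

/-- A map `ρ` from `G(p, TZ)` to itself is smooth at `ξ`, for the smooth structure of `G(p, TZ)` as
the quotient of the bundle of frames by `GL_p`: around each frame of `ξ`, the map `ρ` lifts to a
smooth map of frames. -/
def SmoothGrassmannMapAt {p : ℕ} (ρ : TangentPlane E Z p → TangentPlane E Z p)
    (ξ : TangentPlane E Z p) : Prop :=
  ∀ A : Tuples E Z p, IsFrameOf A ξ → ∃ R : Tuples E Z p → Tuples E Z p,
    ContMDiffAt (𝓘(ℝ, E).prod 𝓘(ℝ, EuclideanSpace ℝ (Fin p) →L[ℝ] E))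
      (𝓘(ℝ, E).prod 𝓘(ℝ, EuclideanSpace ℝ (Fin p) →L[ℝ] E)) ∞ R A ∧
    ∀ᶠ A' in 𝓝 A, ∀ ξ', IsFrameOf A' ξ' → IsFrameOf (R A') (ρ ξ')

/-- `𝒢 ⊆ G(p, TZ)` admits a smooth neighbourhood retraction that preserves the fibres of
`G(p, TZ) → Z`. -/
def HasSmoothFibrewiseRetraction {p : ℕ} (𝒢 : Set (TangentPlane E Z p)) : Prop :=
  ∃ (N : Set (TangentPlane E Z p)) (ρ : TangentPlane E Z p → TangentPlane E Z p),
    IsOpen N ∧ 𝒢 ⊆ N ∧ (∀ ξ ∈ N, ρ ξ ∈ 𝒢) ∧ (∀ ξ ∈ 𝒢, ρ ξ = ξ) ∧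
    (∀ ξ ∈ N, (ρ ξ).base = ξ.base) ∧ ∀ ξ ∈ N, SmoothGrassmannMapAt ρ ξ

/-! ### Plurisubharmonic functions -/

/-- `e` is an orthonormal basis, for the metric `g`, of the plane `ξ`. -/
def IsOrthonormalBasisOf {p : ℕ} (g : BilinearField E Z) (ξ : TangentPlane E Z p)
    (e : Fin p → TangentSpace 𝓘(ℝ, E) ξ.base) : Prop :=
  (∀ j k, g ξ.base (e j) (e k) = if j = k then 1 else 0) ∧
    Submodule.span ℝ (Set.range e) = ξ.plane

/-- `φ` is a test function for `u` at `z`: it is `C²` near `z`, `u ≤ φ` near `z`, and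
`u(z) = φ(z)`. -/
def IsTestFunction (u : Z → EReal) (z : Z) (φ : Z → ℝ) : Prop :=
  ContMDiffAt 𝓘(ℝ, E) 𝓘(ℝ, ℝ) 2 φ z ∧ (∀ᶠ z' in 𝓝 z, u z' ≤ (φ z' : EReal)) ∧
    u z = (φ z : EReal)

/-- `u : Z → [-∞, ∞)` is upper semi-continuous and `𝒢`-plurisubharmonic: every test function `φ`
for `u` at a point satisfies `trace (Hess φ|_ξ) ≥ 0` for every `ξ ∈ 𝒢` at that point, the trace being
computed in an orthonormal basis of `ξ`. -/
def IsPlurisubharmonic {p : ℕ} (g : BilinearField E Z) (𝒢 : Set (TangentPlane E Z p))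
    (u : Z → EReal) : Prop :=
  UpperSemicontinuous u ∧ (∀ z, u z ≠ ⊤) ∧
    ∀ ξ ∈ 𝒢, ∀ φ : Z → ℝ, IsTestFunction (E := E) u ξ.base φ →
      ∀ e, IsOrthonormalBasisOf g ξ e → 0 ≤ ∑ j, hessian g φ ξ.base (e j) (e j)

/-! ### Flat submanifolds -/

/-- `𝒢(TX)`: the tangent `p`-planes of the submanifold `f : X → Z` that are `𝒢`-planes of `Z`. -/
def tangentPlanes {p : ℕ} (f : X → Z) (𝒢 : Set (TangentPlane E Z p)) :
    Set (TangentPlane F X p) :=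
  {η | ∃ ξ ∈ 𝒢, ∃ h, (⟨f η.base, η.plane.map (differential f η.base).toLinearMap, h⟩ :
    TangentPlane E Z p) = ξ}

/-- `X` is `𝒢`-regular: each `η₀ ∈ 𝒢(TX)` extends to a smooth field of planes in `𝒢(TX)` on a
neighbourhood, in `X`, of its foot point. -/
def IsRegular {p : ℕ} (f : X → Z) (𝒢 : Set (TangentPlane E Z p)) : Prop :=
  ∀ η₀ ∈ tangentPlanes (F := F) f 𝒢, ∃ (U : Set X) (η : X → TangentPlane F X p),
    IsOpen U ∧ η₀.base ∈ U ∧ η η₀.base = η₀ ∧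
    ∀ x ∈ U, (η x).base = x ∧ η x ∈ tangentPlanes f 𝒢 ∧ SmoothPlaneFieldAt η x

/-- `X` is `𝒢`-flat: it is `𝒢`-regular, and `trace (B|_η) = 0` for all `η ∈ 𝒢(TX)`. -/
def IsFlat {p : ℕ} (g : BilinearField E Z) (f : X → Z) (𝒢 : Set (TangentPlane E Z p)) : Prop :=
  IsRegular (F := F) f 𝒢 ∧
    ∀ η ∈ tangentPlanes (F := F) f 𝒢, ∀ e, IsOrthonormalBasisOf (pullbackMetric f g) η e →
      ∑ j, secondFundamentalForm g f η.base (e j) (e j) = 0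

end GeometricRestriction

end

/-! Near a point, take charts in which the immersion is a linear inclusion `J` with linear
retraction `Q` and image `{P = 0}`. A test function for `u ∘ i` extends, constantly along the fibres
of `Q`, to a function `f` with `u ≤ f` on `{P = 0}`. Off this set nothing is known, so a penalty is
added: `u - f - δ |y - y₀|² - n ‖P y‖²` is maximised on a small ball. Along a subsequence the
maximum points `y_n` tend to `y₀` and `n ‖P y_n‖² → 0` (`exists_seq_penalized_max`). At each `y_n`
close to `y₀`, plurisubharmonicity may be tested on any `𝒢`-plane.

The point is to choose these planes well. Regularity gives a smooth field of `𝒢`-planes tangent to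
the submanifold. Its frame is extended constantly along `Q` and pushed back into `𝒢` by the
retraction; the result is a smooth ambient frame `β` of `𝒢`-planes, tangent to the submanifold along
it (`exists_smooth_frame_extension`).

The trace over `β` of the Hessian of `‖P‖²` is a term quadratic in `P β` minus twice the pairing of
`P y` with a vector `κ y`, the `P`-component of the trace of the Christoffel symbols. On `{P = 0}`,
`P β` vanishes by tangency and `κ` because the trace of `B` does. Both are C¹, hence `O(‖P‖)`, so
the trace is `O(‖P‖²)` (`frameTrace_norm_sq_isBigO`) and survives multiplication by `n`: it still
tends to `0`. Letting `n → ∞` and then `δ → 0` gives a nonnegative trace for `f` at `y₀`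
(`frameTrace_nonneg`). Vanishing of the trace of `B` also identifies this with the intrinsic trace
(`sum_hessian_comp`). -/

set_option maxSynthPendingDepth 3

namespace GeometricRestriction

/-! ### Christoffel symbols and Hessians in coordinates, and their behaviour under maps -/

section VectorSpace

variable {E : Type*} [NormedAddCommGroup E] [NormedSpace ℝ E]
  {F : Type*} [NormedAddCommGroup F] [NormedSpace ℝ F]

/-- The Hessian of a function on an open subset of a vector space, for a metric `h` on it. -/
noncomputable def localHessian (h : E → E →L[ℝ] E →L[ℝ] ℝ) (f : E → ℝ) (y v w : E) : ℝ :=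
  fderiv ℝ (fderiv ℝ f) y v w - fderiv ℝ f y (christoffel h y v w)

/-- A symmetric positive definite bilinear form. -/
structure IsInnerProduct (b : E →L[ℝ] E →L[ℝ] ℝ) : Prop where
  symm : ∀ v w, b v w = b w v
  pos : ∀ v, v ≠ 0 → 0 < b v v

theorem IsInnerProduct.eq_zero {b : E →L[ℝ] E →L[ℝ] ℝ} (hb : IsInnerProduct b) {v : E}
    (hv : ∀ w, b v w = 0) : v = 0 := by
  by_contra hne
  exact (hb.pos v hne).ne' (hv v)

theorem IsInnerProduct.eq_of {b : E →L[ℝ] E →L[ℝ] ℝ} (hb : IsInnerProduct b) {v w : E}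
    (hvw : ∀ a, b v a = b w a) : v = w :=
  sub_eq_zero.1 (hb.eq_zero fun a => by simp [hvw a])

/-- Definiteness gives injectivity, and `E` and its dual have equal dimension. Needed because
`inverse`, used in `christoffel`, is zero on maps that are not invertible. -/
theorem IsInnerProduct.isInvertible [FiniteDimensional ℝ E] {b : E →L[ℝ] E →L[ℝ] ℝ}
    (hb : IsInnerProduct b) : b.IsInvertible := by
  have hinj : Function.Injective b.toLinearMap := fun v w hvw =>
    hb.eq_of fun a => congrArg (fun ℓ : E →L[ℝ] ℝ => ℓ a) hvw
  have hdim : finrank ℝ E = finrank ℝ (E →L[ℝ] ℝ) := by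
    rw [← (LinearMap.toContinuousLinearMap (𝕜 := ℝ) (E := E) (F' := ℝ)).finrank_eq]
    exact (Subspace.dual_finrank_eq (K := ℝ) (V := E)).symm
  refine ⟨(LinearEquiv.ofInjectiveOfFinrankEq b.toLinearMap hinj hdim).toContinuousLinearEquiv, ?_⟩
  ext v w
  rfl

theorem christoffel_spec {h : E → E →L[ℝ] E →L[ℝ] ℝ} {y : E} (hy : (h y).IsInvertible)
    (v w a : E) : h y (christoffel h y v w) a =
      (1 / 2 : ℝ) * (fderiv ℝ h y v w a + fderiv ℝ h y w v a - fderiv ℝ h y a v w) := by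
  rw [christoffel, hy.self_apply_inverse]
  simp

theorem localHessian_congr {h h' : E → E →L[ℝ] E →L[ℝ] ℝ} {f f' : E → ℝ} {y : E}
    (hh : h =ᶠ[𝓝 y] h') (hf : f =ᶠ[𝓝 y] f') (v w : E) :
    localHessian h f y v w = localHessian h' f' y v w := by
  simp only [localHessian, christoffel, hh.fderiv_eq, hh.eq_of_nhds, hf.fderiv_eq,
    hf.fderiv.fderiv_eq]

theorem localHessian_const (h : E → E →L[ℝ] E →L[ℝ] ℝ) (c : ℝ) (y v w : E) :
    localHessian h (fun _ => c) y v w = 0 := by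
  have h : fderiv ℝ (fun _ : E => c) = fun _ => 0 := by
    ext y
    simp
  simp [localHessian, h]

/-- Second-order chain rule. The term in the second derivative of `c` is the one that the
Christoffel symbols have to absorb. -/
theorem fderiv_fderiv_comp {c : F → E} {f : E → ℝ} {a : F} (hc : ContDiffAt ℝ 2 c a)
    (hf : ContDiffAt ℝ 2 f (c a)) (v w : F) :
    fderiv ℝ (fderiv ℝ (f ∘ c)) a v w =
      fderiv ℝ (fderiv ℝ f) (c a) (fderiv ℝ c a v) (fderiv ℝ c a w) +
        fderiv ℝ f (c a) (fderiv ℝ (fderiv ℝ c) a v w) := by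
  have hc' : ∀ᶠ y in 𝓝 a, DifferentiableAt ℝ c y :=
    (hc.eventually (by simp)).mono fun y hy => hy.differentiableAt (by norm_num)
  have hf' : ∀ᶠ y in 𝓝 a, DifferentiableAt ℝ f (c y) :=
    hc.continuousAt.eventually
      ((hf.eventually (by simp)).mono fun y hy => hy.differentiableAt (by norm_num))
  have heq : fderiv ℝ (f ∘ c) =ᶠ[𝓝 a] fun y => (fderiv ℝ f (c y)).comp (fderiv ℝ c y) := by
    filter_upwards [hc', hf'] with y h1 h2
    exact fderiv_comp y h2 h1
  have h1 : DifferentiableAt ℝ (fderiv ℝ c) a :=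
    (hc.fderiv_right (m := 1) (by norm_num)).differentiableAt (by norm_num)
  have h2 : DifferentiableAt ℝ (fderiv ℝ f) (c a) :=
    (hf.fderiv_right (m := 1) (by norm_num)).differentiableAt (by norm_num)
  have h3 : HasFDerivAt (fun y => fderiv ℝ f (c y)) _ a :=
    h2.hasFDerivAt.comp a hc'.self_of_nhds.hasFDerivAt
  rw [heq.fderiv_eq, (h3.clm_comp h1.hasFDerivAt).fderiv]
  simp [add_comm]

/-- The Christoffel symbols of the metric `h'` induced by `h` on an immersed submanifold `c`. -/
theorem christoffel_pullback {c : F → E} {h : E → E →L[ℝ] E →L[ℝ] ℝ} {h' : F → F →L[ℝ] F →L[ℝ] ℝ}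
    {a : F} (hc : ContDiffAt ℝ 2 c a) (hh : DifferentiableAt ℝ h (c a))
    (hh' : DifferentiableAt ℝ h' a)
    (heq : ∀ᶠ y in 𝓝 a, ∀ s t, h' y s t = h (c y) (fderiv ℝ c y s) (fderiv ℝ c y t))
    (hsymm : ∀ s t, h (c a) s t = h (c a) t s) (hi : (h (c a)).IsInvertible)
    (hi' : (h' a).IsInvertible) (v w t : F) :
    h' a (christoffel h' a v w) t = h (c a) (fderiv ℝ (fderiv ℝ c) a v w +
      christoffel h (c a) (fderiv ℝ c a v) (fderiv ℝ c a w)) (fderiv ℝ c a t) := by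
  have h1 : DifferentiableAt ℝ (fderiv ℝ c) a :=
    (hc.fderiv_right (m := 1) (by norm_num)).differentiableAt (by norm_num)
  have hca : DifferentiableAt ℝ c a := hc.differentiableAt (by norm_num)
  -- Product rule applied to `heq`.
  have key : ∀ v w t : F, fderiv ℝ h' a v w t =
      fderiv ℝ h (c a) (fderiv ℝ c a v) (fderiv ℝ c a w) (fderiv ℝ c a t) +
      h (c a) (fderiv ℝ (fderiv ℝ c) a v w) (fderiv ℝ c a t) +
      h (c a) (fderiv ℝ c a w) (fderiv ℝ (fderiv ℝ c) a v t) := by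
    intro v w t
    have e1 : HasFDerivAt (fun y => h' y w t) _ a :=
      (hh'.hasFDerivAt.clm_apply (hasFDerivAt_const w a)).clm_apply (hasFDerivAt_const t a)
    have e2 : (fun y => h' y w t) =ᶠ[𝓝 a]
        fun y => h (c y) (fderiv ℝ c y w) (fderiv ℝ c y t) := by
      filter_upwards [heq] with y hy using hy w t
    have d1 : HasFDerivAt (fun y => h (c y)) ((fderiv ℝ h (c a)).comp (fderiv ℝ c a)) a :=
      HasFDerivAt.comp (𝕜 := ℝ) (g := h) (g' := fderiv ℝ h (c a)) (f' := fderiv ℝ c a) a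
        hh.hasFDerivAt hca.hasFDerivAt
    have d2 : ∀ w, HasFDerivAt (fun y => fderiv ℝ c y w) _ a := fun w =>
      h1.hasFDerivAt.clm_apply (hasFDerivAt_const w a)
    have d3 : HasFDerivAt (fun y => h (c y) (fderiv ℝ c y w)) _ a := d1.clm_apply (d2 w)
    have e3 := d3.clm_apply (d2 t)
    have e4 := congrArg (fun ℓ : F →L[ℝ] ℝ => ℓ v) (e1.unique (e3.congr_of_eventuallyEq e2))
    simp at e4
    rw [e4]
    ring
  have hs : ∀ s t, fderiv ℝ (fderiv ℝ c) a s t = fderiv ℝ (fderiv ℝ c) a t s := fun s t =>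
    (hc.isSymmSndFDerivAt (by simp)) s t
  -- In the Koszul combination the mixed terms cancel, by symmetry of `h` and of the second
  -- derivative of `c`; what survives is twice `h (D²c(v, w), Dc t)`.
  rw [map_add, add_apply, christoffel_spec hi, christoffel_spec hi', key, key,
    key, hs w v, hs t v, hs t w, hsymm (fderiv ℝ c a w)]
  ring

/-- `christoffel_pullback` only tests against vectors in the range of `Dc`. When `Dc` is onto it
determines the whole vector, which is the transformation law of Christoffel symbols under a change
of coordinates. -/
theorem localHessian_comp [FiniteDimensional ℝ E] [FiniteDimensional ℝ F]
    {c : F → E} {h : E → E →L[ℝ] E →L[ℝ] ℝ}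
    {h' : F → F →L[ℝ] F →L[ℝ] ℝ} {f : E → ℝ}
    {a : F} (hc : ContDiffAt ℝ 2 c a) (hh : DifferentiableAt ℝ h (c a))
    (hh' : DifferentiableAt ℝ h' a)
    (heq : ∀ᶠ y in 𝓝 a, ∀ s t, h' y s t = h (c y) (fderiv ℝ c y s) (fderiv ℝ c y t))
    (hi : IsInnerProduct (h (c a))) (hi' : IsInnerProduct (h' a))
    (hf : ContDiffAt ℝ 2 f (c a)) (hsurj : Function.Surjective (fderiv ℝ c a)) (v w : F) :
    localHessian h' (f ∘ c) a v w =
      localHessian h f (c a) (fderiv ℝ c a v) (fderiv ℝ c a w) := by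
  have key : fderiv ℝ c a (christoffel h' a v w) = fderiv ℝ (fderiv ℝ c) a v w +
      christoffel h (c a) (fderiv ℝ c a v) (fderiv ℝ c a w) := by
    refine hi.eq_of fun b => ?_
    obtain ⟨t, rfl⟩ := hsurj b
    rw [← heq.self_of_nhds, christoffel_pullback hc hh hh' heq hi.symm hi.isInvertible
      hi'.isInvertible]
  rw [localHessian, localHessian, fderiv_fderiv_comp hc hf,
    fderiv_comp a (hf.differentiableAt (by norm_num)) (hc.differentiableAt (by norm_num)),
    ContinuousLinearMap.comp_apply, key, map_add]
  ring

/-- For a submanifold `Dc` is not onto, and `christoffel_pullback` sees only tangential components.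
Hypothesis `he` says that the sum of the covariant derivatives is tangential, so after summation
nothing is lost; this is how the vanishing trace of `B` enters. -/
theorem sum_localHessian_comp [FiniteDimensional ℝ E] [FiniteDimensional ℝ F]
    {c : F → E} {h : E → E →L[ℝ] E →L[ℝ] ℝ}
    {h' : F → F →L[ℝ] F →L[ℝ] ℝ} {f : E → ℝ}
    {a : F} (hc : ContDiffAt ℝ 2 c a) (hh : DifferentiableAt ℝ h (c a))
    (hh' : DifferentiableAt ℝ h' a)
    (heq : ∀ᶠ y in 𝓝 a, ∀ s t, h' y s t = h (c y) (fderiv ℝ c y s) (fderiv ℝ c y t))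
    (hi : IsInnerProduct (h (c a))) (hi' : IsInnerProduct (h' a))
    (hf : ContDiffAt ℝ 2 f (c a)) {ι : Type*} [Fintype ι] (e : ι → F)
    (he : ∃ t, ∑ j, (fderiv ℝ (fderiv ℝ c) a (e j) (e j) +
      christoffel h (c a) (fderiv ℝ c a (e j)) (fderiv ℝ c a (e j))) = fderiv ℝ c a t) :
    ∑ j, localHessian h' (f ∘ c) a (e j) (e j) =
      ∑ j, localHessian h f (c a) (fderiv ℝ c a (e j)) (fderiv ℝ c a (e j)) := by
  obtain ⟨t, ht⟩ := he
  have key : ∑ j, christoffel h' a (e j) (e j) = t := by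
    refine hi'.eq_of fun b => ?_
    rw [heq.self_of_nhds t, ← ht]
    simp only [map_sum, sum_apply]
    exact Finset.sum_congr rfl fun j _ => christoffel_pullback hc hh hh' heq hi.symm
      hi.isInvertible hi'.isInvertible _ _ _
  have h2 : fderiv ℝ (f ∘ c) a = (fderiv ℝ f (c a)).comp (fderiv ℝ c a) :=
    fderiv_comp a (hf.differentiableAt (by norm_num)) (hc.differentiableAt (by norm_num))
  simp only [localHessian, fderiv_fderiv_comp hc hf, Finset.sum_sub_distrib, Finset.sum_add_distrib]
  rw [← map_sum (fderiv ℝ (f ∘ c) a), key, h2, ContinuousLinearMap.comp_apply, ← ht, Finset.sum_add_distrib, map_add,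
    map_sum, map_sum]
  ring

end VectorSpace

/-! ### Traces over a plane and Gram matrices -/

section LinearAlgebra

variable {E : Type*} [NormedAddCommGroup E] [NormedSpace ℝ E]

/-- The Gram matrix of a family of vectors. -/
noncomputable def gram {p : ℕ} (b : E →L[ℝ] E →L[ℝ] ℝ) (β : Fin p → E) : Matrix (Fin p) (Fin p) ℝ :=
  Matrix.of fun j k => b (β j) (β k)

/-- The trace of a bilinear form over a plane in terms of a frame of the plane. -/
theorem exists_gram_inv_sum_eq {p : ℕ} {b : E →L[ℝ] E →L[ℝ] ℝ} {e β : Fin p → E}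
    (he : ∀ j k, b (e j) (e k) = if j = k then 1 else 0)
    (hspan : Submodule.span ℝ (Set.range e) = Submodule.span ℝ (Set.range β)) :
    IsUnit (gram b β).det ∧ ∀ S : E →ₗ[ℝ] E →ₗ[ℝ] ℝ,
    ∑ j, S (e j) (e j) = ∑ j, ∑ k, (gram b β)⁻¹ j k * S (β j) (β k) := by
  have h1 : ∀ k, ∃ c : Fin p → ℝ, ∑ j, c j • e j = β k := fun k =>
    (Submodule.mem_span_range_iff_exists_fun ℝ).1
      (hspan ▸ Submodule.subset_span (Set.mem_range_self k))
  have h2 : ∀ k, ∃ c : Fin p → ℝ, ∑ j, c j • β j = e k := fun k =>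
    (Submodule.mem_span_range_iff_exists_fun ℝ).1
      (hspan ▸ Submodule.subset_span (Set.mem_range_self k))
  choose N hN using h1
  choose M hM using h2
  have hNb : ∀ k l, b (β k) (e l) = N k l := by
    intro k l
    rw [← hN k]
    simp [he]
  have hMN : Matrix.of M * Matrix.of N = 1 := by
    ext k l
    rw [Matrix.mul_apply, Matrix.one_apply, ← he, ← hM k]
    simp [hNb]
  have hNM : Matrix.of N * Matrix.of M = 1 := mul_eq_one_comm.1 hMN
  -- `N` and `M` are the mutually inverse change-of-frame matrices, so the inverse of the Gram
  -- matrix is `Mᵀ M`. Independence of `β` is not assumed: it follows because `β` has `p` members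
  -- and spans the same plane as `e`.
  have hG : gram b β = Matrix.of N * (Matrix.of N).transpose := by
    ext k l
    rw [gram, Matrix.of_apply, Matrix.mul_apply, ← hN l]
    simp [hNb, mul_comm]
  have hinv : gram b β * ((Matrix.of M).transpose * Matrix.of M) = 1 := by
    rw [hG, Matrix.mul_assoc, ← Matrix.mul_assoc (Matrix.of N).transpose, ← Matrix.transpose_mul,
      hMN, Matrix.transpose_one, Matrix.one_mul, hNM]
  refine ⟨Matrix.isUnit_det_of_right_inverse hinv, fun S => ?_⟩
  rw [Matrix.inv_eq_right_inv hinv]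
  have h3 : ∀ i, S (e i) (e i) = ∑ j, ∑ k, M i j * M i k * S (β j) (β k) := by
    intro i
    rw [← hM i]
    simp only [map_sum, LinearMap.sum_apply, map_smul, LinearMap.smul_apply, smul_eq_mul,
      Finset.mul_sum]
    refine Finset.sum_comm.trans ?_
    exact Finset.sum_congr rfl fun j _ => Finset.sum_congr rfl fun k _ => by ring
  simp only [h3, Matrix.mul_apply, Matrix.transpose_apply, Matrix.of_apply, Finset.sum_mul]
  rw [Finset.sum_comm]
  exact Finset.sum_congr rfl fun j _ => Finset.sum_comm

/-- The form `b` is unrelated to the norm of `E`, so a `b`-orthogonal basis of `W` is normalised by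
hand. -/
theorem IsInnerProduct.exists_orthonormal {p : ℕ} {b : E →L[ℝ] E →L[ℝ] ℝ} (hb : IsInnerProduct b)
    (W : Submodule ℝ E) [FiniteDimensional ℝ W] (hW : finrank ℝ W = p) :
    ∃ e : Fin p → E, (∀ j k, b (e j) (e k) = if j = k then 1 else 0) ∧
      Submodule.span ℝ (Set.range e) = W := by
  subst hW
  let B : LinearMap.BilinForm ℝ W :=
    LinearMap.mk₂ ℝ (fun v w : W => b v w) (by simp) (by simp) (by simp) (by simp)
  have hB : LinearMap.IsSymm B := ⟨fun v w => hb.symm v w⟩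
  obtain ⟨v, hv⟩ := LinearMap.BilinForm.exists_orthogonal_basis (K := ℝ) (V := W) (B := B) hB
  have hpos : ∀ j, 0 < b (v j) (v j) := fun j =>
    hb.pos _ (by simpa using v.ne_zero j)
  have hort : ∀ j k, j ≠ k → b (v j) (v k) = 0 := fun j k hjk => hv hjk
  have hs : ∀ j, √(b (v j) (v j)) ≠ 0 := fun j => (Real.sqrt_pos.2 (hpos j)).ne'
  refine ⟨fun j => (√(b (v j) (v j)))⁻¹ • (v j : E), fun j k => ?_, ?_⟩
  · by_cases hjk : j = k
    · subst hjk
      simp only [map_smul, smul_apply, smul_eq_mul, if_true]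
      field_simp [hs j]
      rw [Real.sq_sqrt (hpos j).le]
    · simp [hort j k hjk, hjk]
  · have h1 : Submodule.span ℝ (Set.range fun j => (v j : E)) = W := by
      have := congrArg (Submodule.map W.subtype) v.span_eq
      rw [Submodule.map_span, Submodule.map_top, Submodule.range_subtype, ← Set.range_comp] at this
      exact this
    conv_rhs => rw [← h1]
    apply le_antisymm
    · rw [Submodule.span_le]
      rintro _ ⟨j, rfl⟩
      exact Submodule.smul_mem _ _ (Submodule.subset_span ⟨j, rfl⟩)
    · rw [Submodule.span_le]
      rintro _ ⟨j, rfl⟩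
      have := Submodule.smul_mem (Submodule.span ℝ (Set.range fun j =>
        (√(b (v j) (v j)))⁻¹ • (v j : E))) (√(b (v j) (v j))) (Submodule.subset_span ⟨j, rfl⟩)
      simpa [smul_smul, hs j] using this

end LinearAlgebra

/-! ### Penalised maxima of upper semi-continuous functions -/

section Maximum

open Filter

/-- Penalization: if `u` touches `f` from below at `y₀` along the zero set of `q ≥ 0`, strictly away
from `y₀`, then the maximum points of `u - f - n q` converge to `y₀` with `n q → 0`, along a
subsequence. -/
theorem exists_seq_penalized_max {E : Type*} [TopologicalSpace E] [FirstCountableTopology E]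
    {K : Set E} (hK : IsCompact K) {u : E → EReal} {f q : E → ℝ}
    (hu : UpperSemicontinuousOn u K) (htop : ∀ y ∈ K, u y ≠ ⊤) (hf : ContinuousOn f K)
    (hq : ContinuousOn q K) (hq0 : ∀ y, 0 ≤ q y) {y₀ : E} (hy₀ : y₀ ∈ K) (hqy₀ : q y₀ = 0)
    (huy₀ : u y₀ = f y₀) (hlt : ∀ y ∈ K, q y = 0 → y ≠ y₀ → u y < f y) :
    ∃ (y : ℕ → E) (n : ℕ → ℕ) (c : ℕ → ℝ), Tendsto y atTop (𝓝 y₀) ∧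
      Tendsto (fun k => n k * q (y k)) atTop (𝓝 0) ∧
      ∀ k, y k ∈ K ∧ u (y k) = ((f (y k) + n k * q (y k) + c k : ℝ) : EReal) ∧
        ∀ z ∈ K, u z ≤ ((f z + n k * q z + c k : ℝ) : EReal) := by
  -- `c` is the maximum of `u - f - n q` on `K`. The value at `y₀` is `0`, so `c ≥ 0` and `u` is
  -- finite at the maximum point.
  have hmax : ∀ n : ℕ, ∃ y ∈ K, ∃ c : ℝ, 0 ≤ c ∧ u y = ((f y + n * q y + c : ℝ) : EReal) ∧
      ∀ z ∈ K, u z ≤ ((f z + n * q z + c : ℝ) : EReal) := by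
    intro n
    have hcont : ContinuousOn (fun y => ((-(f y + n * q y) : ℝ) : EReal)) K :=
      continuous_coe_real_ereal.comp_continuousOn
        (hf.add (continuousOn_const.mul hq)).neg
    have husc : UpperSemicontinuousOn (fun y => u y + ((-(f y + n * q y) : ℝ) : EReal)) K :=
      hu.add' hcont.upperSemicontinuousOn fun y hy =>
        EReal.continuousAt_add (Or.inl (htop y hy)) (Or.inr (EReal.coe_ne_top _))
    obtain ⟨y, hyK, hy⟩ := husc.exists_isMaxOn ⟨y₀, hy₀⟩ hK
    have h0 : (0 : EReal) ≤ u y + ((-(f y + n * q y) : ℝ) : EReal) := by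
      refine le_trans (le_of_eq ?_) (hy hy₀)
      simp only [huy₀, hqy₀, ← EReal.coe_add]
      norm_num
    have hbot : u y ≠ ⊥ := by
      intro hb
      rw [hb, EReal.bot_add] at h0
      simp at h0
    obtain ⟨U, hU⟩ : ∃ U : ℝ, u y = U := ⟨_, (EReal.coe_toReal (htop y hyK) hbot).symm⟩
    refine ⟨y, hyK, U - (f y + n * q y), ?_, ?_, ?_⟩
    · rw [hU, ← EReal.coe_add] at h0
      have := EReal.coe_le_coe_iff.1 h0
      linarith
    · rw [hU]
      congr 1
      ring
    · intro z hz
      have h1 : u z + ((-(f z + n * q z) : ℝ) : EReal) ≤ u y + ((-(f y + n * q y) : ℝ) : EReal) :=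
        hy hz
      by_cases hzb : u z = ⊥
      · rw [hzb]
        exact bot_le
      · obtain ⟨V, hV⟩ : ∃ V : ℝ, u z = V := ⟨_, (EReal.coe_toReal (htop z hz) hzb).symm⟩
        rw [hV, hU, ← EReal.coe_add, ← EReal.coe_add] at h1
        have := EReal.coe_le_coe_iff.1 h1
        rw [hV]
        exact EReal.coe_le_coe_iff.2 (by linarith)
  choose y hyK c hc hyu hle using hmax
  obtain ⟨M, hM⟩ := (hK.image_of_continuousOn hf).bddAbove
  obtain ⟨m, hm⟩ := (hK.image_of_continuousOn hf).bddBelow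
  -- The case `n = 0` bounds `u` above on `K`; hence `n q (y n)` is bounded, and `q` tends to `0`
  -- along the subsequence.
  have hC : ∀ z ∈ K, u z ≤ ((M + c 0 : ℝ) : EReal) := fun z hz => (hle 0 z hz).trans
    (EReal.coe_le_coe_iff.2 (by simpa using hM ⟨z, hz, rfl⟩))
  have hbd : ∀ n : ℕ, n * q (y n) ≤ M + c 0 - m := by
    intro n
    have h1 := hC _ (hyK n)
    rw [hyu, EReal.coe_le_coe_iff] at h1
    have h2 := hm ⟨y n, hyK n, rfl⟩
    linarith [hc n]
  obtain ⟨a, haK, σ, hσ, hlim⟩ := hK.tendsto_subseq hyK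
  have hlim' : Tendsto (y ∘ σ) atTop (𝓝[K] a) :=
    tendsto_nhdsWithin_iff.2 ⟨hlim, Eventually.of_forall fun k => hyK _⟩
  have hqlim : Tendsto (fun k => q (y (σ k))) atTop (𝓝 0) := by
    have h1 : Tendsto (fun k => (M + c 0 - m) / (σ k : ℝ)) atTop (𝓝 0) :=
      tendsto_const_nhds.div_atTop (tendsto_natCast_atTop_atTop.comp hσ.tendsto_atTop)
    refine tendsto_of_tendsto_of_tendsto_of_le_of_le' tendsto_const_nhds h1
      (Eventually.of_forall fun k => hq0 _) ?_
    filter_upwards [hσ.tendsto_atTop.eventually_gt_atTop 0] with k hk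
    rw [le_div_iff₀ (by exact_mod_cast hk), mul_comm]
    exact hbd _
  have hqa : q a = 0 := tendsto_nhds_unique ((hq a haK).tendsto.comp hlim') hqlim
  have hflim : Tendsto (fun k => f (y (σ k))) atTop (𝓝 (f a)) := (hf a haK).tendsto.comp hlim'
  have hnq : ∀ n : ℕ, 0 ≤ n * q (y n) := fun n => mul_nonneg n.cast_nonneg (hq0 _)
  -- Otherwise `u a < f a`, and semi-continuity contradicts `f ≤ u` at the maximum points.
  have haeq : a = y₀ := by
    by_contra hne
    obtain ⟨r, hr1, hr2⟩ := EReal.lt_iff_exists_real_btwn.1 (hlt a haK hqa hne)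
    have h1 := hlim'.eventually (hu a haK r hr1)
    have h2 := hflim.eventually (lt_mem_nhds (EReal.coe_lt_coe_iff.1 hr2))
    obtain ⟨k, hk1, hk2⟩ := (h1.and h2).exists
    simp only [Function.comp_apply, hyu, EReal.coe_lt_coe_iff] at hk1
    linarith [hc (σ k), hnq (σ k)]
  subst haeq
  refine ⟨y ∘ σ, σ, c ∘ σ, hlim, ?_, fun k => ⟨hyK _, hyu _, hle _⟩⟩
  -- At the maximum points `n q ≤ u - f`, whose upper limit is at most `u a - f a = 0`.
  rw [Metric.tendsto_atTop']
  intro ε hε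
  have h1 := hlim'.eventually (hu a haK ((f a + ε / 2 : ℝ) : EReal)
    (by show u a < _; rw [huy₀, EReal.coe_lt_coe_iff]; linarith))
  have h2 := hflim.eventually (lt_mem_nhds (show f a - ε / 2 < f a by linarith))
  obtain ⟨k₀, hk₀⟩ := eventually_atTop.1 (h1.and h2)
  refine ⟨k₀, fun k hk => ?_⟩
  obtain ⟨hk1, hk2⟩ := hk₀ k hk.le
  simp only [Function.comp_apply, hyu, EReal.coe_lt_coe_iff] at hk1
  rw [Real.dist_0_eq_abs, Function.comp_apply, abs_of_nonneg (hnq _)]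
  linarith [hc (σ k)]

end Maximum

/-! ### The restriction theorem in coordinates -/

section Local

open Filter Asymptotics

variable {E : Type*} [NormedAddCommGroup E] [NormedSpace ℝ E]
  {V : Type*} [NormedAddCommGroup V] [InnerProductSpace ℝ V]

theorem christoffel_add_left (h : E → E →L[ℝ] E →L[ℝ] ℝ) (y v v' w : E) :
    christoffel h y (v + v') w = christoffel h y v w + christoffel h y v' w := by
  simp only [christoffel, ← map_add, ← smul_add]
  congr 2
  ext a
  simp
  ring

theorem christoffel_smul_left (h : E → E →L[ℝ] E →L[ℝ] ℝ) (y v w : E) (t : ℝ) :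
    christoffel h y (t • v) w = t • christoffel h y v w := by
  simp only [christoffel, ← map_smul]
  congr 1
  ext a
  simp
  ring

theorem christoffel_add_right (h : E → E →L[ℝ] E →L[ℝ] ℝ) (y v w w' : E) :
    christoffel h y v (w + w') = christoffel h y v w + christoffel h y v w' := by
  simp only [christoffel, ← map_add, ← smul_add]
  congr 2
  ext a
  simp
  ring

theorem christoffel_smul_right (h : E → E →L[ℝ] E →L[ℝ] ℝ) (y v w : E) (t : ℝ) :
    christoffel h y v (t • w) = t • christoffel h y v w := by
  simp only [christoffel, ← map_smul]
  congr 1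
  ext a
  simp
  ring

/-- The Hessian of `f` at `y` as a bilinear form. -/
noncomputable def hessianForm (h : E → E →L[ℝ] E →L[ℝ] ℝ) (f : E → ℝ) (y : E) :
    E →ₗ[ℝ] E →ₗ[ℝ] ℝ :=
  LinearMap.mk₂ ℝ (localHessian h f y)
    (fun v v' w => by simp [localHessian, christoffel_add_left]; ring)
    (fun t v w => by simp [localHessian, christoffel_smul_left]; ring)
    (fun v w w' => by simp [localHessian, christoffel_add_right]; ring)
    (fun t v w => by simp [localHessian, christoffel_smul_right]; ring)

/-- The trace of the Hessian of `f` at `y` over the plane with frame `β y`. -/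
noncomputable def frameTrace {p : ℕ} (h : E → E →L[ℝ] E →L[ℝ] ℝ) (β : E → Fin p → E) (f : E → ℝ)
    (y : E) : ℝ :=
  ∑ j, ∑ k, (gram (h y) (β y))⁻¹ j k * localHessian h f y (β y j) (β y k)

/-- Passing from an orthonormal basis, chosen point by point, to the moving frame `β` makes the
regularity of the trace in `y` visible. -/
theorem sum_localHessian_eq_frameTrace {p : ℕ} {h : E → E →L[ℝ] E →L[ℝ] ℝ} {β : E → Fin p → E}
    {y : E} {e : Fin p → E} (he : ∀ j k, h y (e j) (e k) = if j = k then 1 else 0)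
    (hspan : Submodule.span ℝ (Set.range e) = Submodule.span ℝ (Set.range (β y))) (f : E → ℝ) :
    ∑ j, localHessian h f y (e j) (e j) = frameTrace h β f y :=
  (exists_gram_inv_sum_eq he hspan).2 (hessianForm h f y)

theorem contDiffAt_det {n : WithTop ℕ∞} {p : ℕ} {A : E → Matrix (Fin p) (Fin p) ℝ} {y : E}
    (hA : ∀ j k, ContDiffAt ℝ n (fun y => A y j k) y) : ContDiffAt ℝ n (fun y => (A y).det) y := by
  simp only [Matrix.det_apply']
  exact ContDiffAt.sum fun σ _ => contDiffAt_const.mul (contDiffAt_prod fun i _ => hA _ _)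

/-- Cramer's rule: the entries are quotients of determinants. -/
theorem contDiffAt_matrix_inv {n : WithTop ℕ∞} {p : ℕ} {A : E → Matrix (Fin p) (Fin p) ℝ} {y : E}
    (hA : ∀ j k, ContDiffAt ℝ n (fun y => A y j k) y) (hy : IsUnit (A y).det) (j k : Fin p) :
    ContDiffAt ℝ n (fun y => (A y)⁻¹ j k) y := by
  simp only [Matrix.inv_def, Matrix.smul_apply, smul_eq_mul, Ring.inverse_eq_inv',
    Matrix.adjugate_apply]
  refine ((contDiffAt_det hA).inv hy.ne_zero).mul (contDiffAt_det fun a b => ?_)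
  by_cases hak : a = k
  · simp only [hak, Matrix.updateRow_self]
    exact contDiffAt_const
  · simp only [Matrix.updateRow_ne hak]
    exact hA a b

theorem contDiffAt_clm_of_apply [FiniteDimensional ℝ E] {G H : Type*} [NormedAddCommGroup G]
    [NormedSpace ℝ G] [NormedAddCommGroup H] [NormedSpace ℝ H] {n : WithTop ℕ∞}
    {f : H → E →L[ℝ] G} {y : H} (h : ∀ v, ContDiffAt ℝ n (fun y => f y v) y) :
    ContDiffAt ℝ n f y := by
  let e₁ := ContinuousLinearEquiv.ofFinrankEq (finrank_fin_fun ℝ (n := finrank ℝ E)).symm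
  let e₂ := (e₁.arrowCongr (1 : G ≃L[ℝ] G)).trans (ContinuousLinearEquiv.piRing (Fin (finrank ℝ E)))
  rw [← Function.id_comp f, ← e₂.symm_comp_self]
  exact e₂.symm.contDiff.contDiffAt.comp y (contDiffAt_pi.mpr fun i => h _)

/-- The symbols involve one derivative of `h`, so one order is lost; C¹ is what the Lipschitz
estimate `isBigO_of_vanishing` requires. -/
theorem contDiffAt_christoffel [FiniteDimensional ℝ E] {h : E → E →L[ℝ] E →L[ℝ] ℝ} {y : E}
    (hh : ContDiffAt ℝ 2 h y) (hi : (h y).IsInvertible) {v w : E → E} (hv : ContDiffAt ℝ 1 v y)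
    (hw : ContDiffAt ℝ 1 w y) : ContDiffAt ℝ 1 (fun y => christoffel h y (v y) (w y)) y := by
  have h1 : ContDiffAt ℝ 1 (fderiv ℝ h) y := hh.fderiv_right (m := 1) (by norm_num)
  have h2 : ContDiffAt ℝ 1 (fun y => (h y).inverse) y :=
    (hi.contDiffAt_map_inverse (n := 1)).comp y (hh.of_le (by norm_num))
  have hvw : ContDiffAt ℝ 1 (fun y => fderiv ℝ h y (v y) (w y)) y := (h1.clm_apply hv).clm_apply hw
  have hwv : ContDiffAt ℝ 1 (fun y => fderiv ℝ h y (w y) (v y)) y := (h1.clm_apply hw).clm_apply hv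
  have hfl : ContDiffAt ℝ 1 (fun y => ((fderiv ℝ h y).flip (v y)).flip (w y)) y := by
    refine contDiffAt_clm_of_apply fun a => ?_
    exact (h1.clm_apply contDiffAt_const).clm_apply hv |>.clm_apply hw
  exact h2.clm_apply (((hvw.add hwv).sub hfl).const_smul (1 / 2 : ℝ))

section FrameTrace

variable {p : ℕ} {h : E → E →L[ℝ] E →L[ℝ] ℝ} {β : E → Fin p → E} {y₀ : E}

theorem contDiffAt_gram_inv (hh : ContDiffAt ℝ 1 h y₀) (hβ : ∀ j, ContDiffAt ℝ 1 (fun y => β y j) y₀)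
    (hdet : IsUnit (gram (h y₀) (β y₀)).det) (j k : Fin p) :
    ContDiffAt ℝ 1 (fun y => (gram (h y) (β y))⁻¹ j k) y₀ :=
  contDiffAt_matrix_inv (fun j k => (hh.clm_apply (hβ j)).clm_apply (hβ k)) hdet j k

theorem continuousAt_frameTrace [FiniteDimensional ℝ E] (hh : ContDiffAt ℝ 2 h y₀) (hi : (h y₀).IsInvertible)
    (hβ : ∀ j, ContDiffAt ℝ 1 (fun y => β y j) y₀) (hdet : IsUnit (gram (h y₀) (β y₀)).det)
    {f : E → ℝ} (hf : ContDiffAt ℝ 2 f y₀) : ContinuousAt (frameTrace h β f) y₀ := by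
  have h1 : ContDiffAt ℝ 1 (fderiv ℝ f) y₀ := hf.fderiv_right (by norm_num)
  have h2 : ContDiffAt ℝ 0 (fderiv ℝ (fderiv ℝ f)) y₀ := h1.fderiv_right (by norm_num)
  refine tendsto_finsetSum _ fun j _ => tendsto_finsetSum _ fun k _ => ContinuousAt.mul
    (contDiffAt_gram_inv (hh.of_le (by norm_num)) hβ hdet j k).continuousAt (ContinuousAt.sub ?_ ?_)
  · exact (h2.continuousAt.clm_apply (hβ j).continuousAt).clm_apply (hβ k).continuousAt
  · exact h1.continuousAt.clm_apply (contDiffAt_christoffel hh hi (hβ j) (hβ k)).continuousAt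

theorem frameTrace_add {f f' : E → ℝ} {y : E} (hf : ContDiffAt ℝ 2 f y)
    (hf' : ContDiffAt ℝ 2 f' y) :
    frameTrace h β (fun y => f y + f' y) y = frameTrace h β f y + frameTrace h β f' y := by
  have h1 : fderiv ℝ (fun y => f y + f' y) =ᶠ[𝓝 y] fun y => fderiv ℝ f y + fderiv ℝ f' y := by
    filter_upwards [hf.eventually (by simp), hf'.eventually (by simp)] with z hz hz'
    exact fderiv_fun_add (hz.differentiableAt (by norm_num)) (hz'.differentiableAt (by norm_num))
  have h2 := fderiv_fun_add
    ((hf.fderiv_right (m := 1) (by norm_num)).differentiableAt (by norm_num))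
    ((hf'.fderiv_right (m := 1) (by norm_num)).differentiableAt (by norm_num))
  simp only [frameTrace, localHessian, h1.fderiv_eq, h1.eq_of_nhds, h2, ← Finset.sum_add_distrib]
  refine Finset.sum_congr rfl fun j _ => Finset.sum_congr rfl fun k _ => ?_
  simp only [add_apply]
  ring

theorem frameTrace_const_mul (t : ℝ) {f : E → ℝ} {y : E} (hf : ContDiffAt ℝ 2 f y) :
    frameTrace h β (fun y => t * f y) y = t * frameTrace h β f y := by
  have h1 : fderiv ℝ (fun y => t * f y) =ᶠ[𝓝 y] fun y => t • fderiv ℝ f y := by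
    filter_upwards [hf.eventually (by simp)] with z hz
    exact fderiv_const_mul (hz.differentiableAt (by norm_num)) t
  have h2 := fderiv_fun_const_smul
    ((hf.fderiv_right (m := 1) (by norm_num)).differentiableAt (by norm_num)) t
  simp only [frameTrace, localHessian, h1.fderiv_eq, h1.eq_of_nhds, h2, Finset.mul_sum]
  refine Finset.sum_congr rfl fun j _ => Finset.sum_congr rfl fun k _ => ?_
  simp only [smul_apply, smul_eq_mul]
  ring

theorem frameTrace_const (c : ℝ) (y : E) : frameTrace h β (fun _ => c) y = 0 := by
  simp [frameTrace, localHessian_const]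

theorem localHessian_clm (ℓ : E →L[ℝ] ℝ) (y v w : E) :
    localHessian h ℓ y v w = -ℓ (christoffel h y v w) := by
  have : fderiv ℝ ℓ = fun _ => ℓ := by
    ext y
    simp
  simp [localHessian, this]

/-- Since `P` is linear, the second derivative is constant in `y`; the correction carries a factor
`P y`. -/
theorem localHessian_norm_sq (P : E →L[ℝ] V) (y v w : E) :
    localHessian h (fun y => ‖P y‖ ^ 2) y v w =
      2 * inner ℝ (P v) (P w) - 2 * inner ℝ (P y) (P (christoffel h y v w)) := by
  have h1 : ∀ y w, fderiv ℝ (fun y => ‖P y‖ ^ 2) y w = 2 * inner ℝ (P y) (P w) := by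
    intro y w
    rw [((P.hasFDerivAt (x := y)).norm_sq).fderiv]
    simp
  have h2 : fderiv ℝ (fderiv ℝ (fun y => ‖P y‖ ^ 2)) y v w = 2 * inner ℝ (P v) (P w) := by
    have hc : ContDiff ℝ 2 (fun y => ‖P y‖ ^ 2) := P.contDiff.norm_sq ℝ
    have hd : DifferentiableAt ℝ (fderiv ℝ (fun y => ‖P y‖ ^ 2)) y :=
      (hc.fderiv_right (m := 1) (by norm_num)).differentiable (by norm_num) y
    have h3 := (hd.hasFDerivAt.clm_apply (hasFDerivAt_const w y))
    simp only [h1] at h3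
    have h4 : HasFDerivAt (fun y => 2 * inner ℝ (P y) (P w)) _ y :=
      ((P.hasFDerivAt (x := y)).inner ℝ (hasFDerivAt_const (P w) y)).const_mul 2
    have := congrArg (fun ℓ : E →L[ℝ] ℝ => ℓ v) (h3.unique h4)
    simpa using this
  rw [localHessian, h1, h2]

/-- A C¹ map is locally Lipschitz, and `y` is within `C ‖P y‖` of the point `Q y`, where `φ`
vanishes. -/
theorem isBigO_of_vanishing {G : Type*} [NormedAddCommGroup G] [NormedSpace ℝ G]
    {φ : E → G} {Q : E →L[ℝ] E} {P : E →L[ℝ] V} {C : ℝ} (hφ : ContDiffAt ℝ 1 φ y₀)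
    (hQ : Q y₀ = y₀) (hC : ∀ y, ‖y - Q y‖ ≤ C * ‖P y‖) (hv : ∀ᶠ y in 𝓝 y₀, φ (Q y) = 0) :
    φ =O[𝓝 y₀] P := by
  obtain ⟨L, t, ht, hL⟩ := hφ.exists_lipschitzOnWith
  have hQt : ∀ᶠ y in 𝓝 y₀, Q y ∈ t := Q.continuous.continuousAt.eventually (by rwa [hQ])
  refine IsBigO.of_bound (L * C) ?_
  filter_upwards [ht, hQt, hv] with y h1 h2 h3
  have := hL.norm_sub_le h1 h2
  rw [h3, sub_zero] at this
  rw [mul_assoc]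
  exact this.trans (mul_le_mul_of_nonneg_left (hC y) L.2)

/-- If the frame `β` is tangent to `{P = 0}` along `{P = 0}` and the trace of the second fundamental
form of `{P = 0}` over its span vanishes, the trace of the Hessian of the penalty `‖P y‖²` over the
span of `β` is controlled by the penalty itself. -/
theorem frameTrace_norm_sq_isBigO [FiniteDimensional ℝ E] (hh : ContDiffAt ℝ 2 h y₀) (hi : (h y₀).IsInvertible)
    (hβ : ∀ j, ContDiffAt ℝ 1 (fun y => β y j) y₀) (hdet : IsUnit (gram (h y₀) (β y₀)).det)
    {Q : E →L[ℝ] E} {P : E →L[ℝ] V} {C : ℝ} (hQ : Q y₀ = y₀) (hC : ∀ y, ‖y - Q y‖ ≤ C * ‖P y‖)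
    (htan : ∀ᶠ y in 𝓝 y₀, ∀ j, P (β (Q y) j) = 0)
    (hflat : ∀ᶠ y in 𝓝 y₀, ∀ ℓ : V →L[ℝ] ℝ, frameTrace h β (ℓ ∘L P) (Q y) = 0) :
    frameTrace h β (fun y => ‖P y‖ ^ 2) =O[𝓝 y₀] fun y => ‖P y‖ ^ 2 := by
  -- Chosen so that the trace of the Hessian of `ℓ ∘ P` is `-ℓ (κ y)`, for every linear `ℓ`.
  let κ : E → V := fun y =>
    ∑ j, ∑ k, (gram (h y) (β y))⁻¹ j k • P (christoffel h y (β y j) (β y k))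
  have hW := contDiffAt_gram_inv (hh.of_le (by norm_num)) hβ hdet
  have hκ : ContDiffAt ℝ 1 κ y₀ := ContDiffAt.sum fun j _ => ContDiffAt.sum fun k _ =>
    (hW j k).smul (P.contDiff.contDiffAt.comp y₀ (contDiffAt_christoffel hh hi (hβ j) (hβ k)))
  have hκ0 : ∀ᶠ y in 𝓝 y₀, κ (Q y) = 0 := by
    filter_upwards [hflat] with y hy
    -- Testing `hflat` with the pairing against `κ (Q y)` itself yields `‖κ (Q y)‖² = 0`.
    have h1 := hy (innerSL ℝ (κ (Q y)))
    simp only [frameTrace, localHessian_clm] at h1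
    rw [← inner_self_eq_zero (𝕜 := ℝ), ← neg_eq_zero, ← h1]
    nth_rewrite 2 [show κ (Q y) = ∑ j, ∑ k, (gram (h (Q y)) (β (Q y)))⁻¹ j k •
      P (christoffel h (Q y) (β (Q y) j) (β (Q y) k)) from rfl]
    simp [inner_sum, inner_smul_right]
  have hκO := isBigO_of_vanishing hκ hQ hC hκ0
  have hβO : ∀ j, (fun y => P (β y j)) =O[𝓝 y₀] P := fun j =>
    isBigO_of_vanishing (P.contDiff.contDiffAt.comp y₀ (hβ j)) hQ hC (htan.mono fun y hy => hy j)
  have heq : frameTrace h β (fun y => ‖P y‖ ^ 2) = fun y =>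
      ∑ j, ∑ k, (gram (h y) (β y))⁻¹ j k * (2 * inner ℝ (P (β y j)) (P (β y k))) -
        2 * inner ℝ (P y) (κ y) := by
    ext y
    simp only [frameTrace, localHessian_norm_sq, κ, inner_sum, mul_sub, Finset.sum_sub_distrib,
      inner_smul_right, Finset.mul_sum]
    congr 1
    exact Finset.sum_congr rfl fun j _ => Finset.sum_congr rfl fun k _ => by ring
  rw [heq]
  have hinner : ∀ a b : E → V, a =O[𝓝 y₀] P → b =O[𝓝 y₀] P →
      (fun y => inner ℝ (a y) (b y)) =O[𝓝 y₀] fun y => ‖P y‖ ^ 2 := by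
    intro a b ha hb
    have h1 : (fun y => inner ℝ (a y) (b y)) =O[𝓝 y₀] fun y => ‖a y‖ * ‖b y‖ :=
      IsBigO.of_bound 1 (Eventually.of_forall fun y => by
        simpa using abs_real_inner_le_norm (a y) (b y))
    refine h1.trans ?_
    simp only [pow_two]
    exact ha.norm_norm.mul hb.norm_norm
  refine IsBigO.sub (IsBigO.fun_sum fun j _ => IsBigO.fun_sum fun k _ => ?_)
    ((hinner _ _ (isBigO_refl _ _) hκO).const_mul_left 2)
  simpa using ((hW j k).continuousAt.tendsto.isBigO_one ℝ).mul
    ((hinner _ _ (hβO j) (hβO k)).const_mul_left 2)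

/-- The restriction theorem in coordinates: `u` is assumed plurisubharmonic along the planes with
frame `β`, and `f` is a test function for the restriction of `u` to `{P = 0}`. -/
theorem frameTrace_nonneg [FiniteDimensional ℝ E] (hh : ContDiffAt ℝ 2 h y₀)
    (hi : (h y₀).IsInvertible) (hβ : ∀ j, ContDiffAt ℝ 1 (fun y => β y j) y₀)
    (hdet : IsUnit (gram (h y₀) (β y₀)).det)
    {Q : E →L[ℝ] E} {P : E →L[ℝ] V} {C : ℝ} (hQ : Q y₀ = y₀) (hC : ∀ y, ‖y - Q y‖ ≤ C * ‖P y‖)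
    (hPy₀ : P y₀ = 0) (htan : ∀ᶠ y in 𝓝 y₀, ∀ j, P (β (Q y) j) = 0)
    (hflat : ∀ᶠ y in 𝓝 y₀, ∀ ℓ : V →L[ℝ] ℝ, frameTrace h β (ℓ ∘L P) (Q y) = 0)
    {u : E → EReal} (husc : ∀ᶠ y in 𝓝 y₀, UpperSemicontinuousAt u y) (htop : ∀ y, u y ≠ ⊤)
    (hpsh : ∀ᶠ y in 𝓝 y₀, ∀ f : E → ℝ, ContDiffAt ℝ 2 f y → (∀ᶠ z in 𝓝 y, u z ≤ f z) →
      u y = f y → 0 ≤ frameTrace h β f y)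
    {f : E → ℝ} (hf : ContDiffAt ℝ 2 f y₀) (huf : ∀ᶠ y in 𝓝 y₀, P y = 0 → u y ≤ f y)
    (hufy₀ : u y₀ = f y₀) : 0 ≤ frameTrace h β f y₀ := by
  -- A Euclidean norm is used because the given norm of `E` need not be differentiable. The term `δ
  -- s` makes the contact at `y₀` strict along `{P = 0}`.
  let s : E → ℝ := fun y => ‖toEuclidean (y - y₀)‖ ^ 2
  have hs : ContDiff ℝ 2 s :=
    ((toEuclidean (E := E)).contDiff.comp (contDiff_id.sub contDiff_const)).norm_sq ℝ
  have hq : ContDiff ℝ 2 fun y => ‖P y‖ ^ 2 := P.contDiff.norm_sq ℝ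
  have hs0 : s y₀ = 0 := by simp [s]
  have hspos : ∀ y, y ≠ y₀ → 0 < s y := fun y hy => by
    have : toEuclidean (y - y₀) ≠ 0 := by simpa [sub_eq_zero] using hy
    positivity
  have key : ∀ δ : ℝ, 0 < δ → 0 ≤ frameTrace h β f y₀ + δ * frameTrace h β s y₀ := by
    intro δ hδ
    have hev := (husc.and (hpsh.and (huf.and (hf.eventually (by simp)))))
    obtain ⟨r, hr, hball⟩ := Metric.nhds_basis_closedBall.eventually_iff.1 hev
    let K := Metric.closedBall y₀ r
    have hK : IsCompact K := isCompact_closedBall y₀ r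
    obtain ⟨y, n, c, hy, hnq, hmax⟩ := exists_seq_penalized_max (E := E) hK (u := u)
      (f := fun y => f y + δ * s y) (q := fun y => ‖P y‖ ^ 2)
      (fun y hy => (hball hy).1.upperSemicontinuousWithinAt K) (fun y _ => htop y)
      (fun y hy => ((hball hy).2.2.2.continuousAt.add
        (continuousAt_const.mul hs.continuous.continuousAt)).continuousWithinAt)
      hq.continuous.continuousOn (fun y => by positivity) (y₀ := y₀)
      (Metric.mem_closedBall_self hr.le) (by simp [hPy₀]) (by simp [hufy₀, hs0])
      (fun y hy hPy hne => by
        refine ((hball hy).2.2.1 (by simpa using hPy)).trans_lt (EReal.coe_lt_coe_iff.2 ?_)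
        have := mul_pos hδ (hspos y hne)
        linarith)
    have hyint : ∀ᶠ k in atTop, y k ∈ Metric.ball y₀ r := hy.eventually (Metric.ball_mem_nhds y₀ hr)
    have hnonneg : ∀ᶠ k in atTop, 0 ≤ frameTrace h β f (y k) + δ * frameTrace h β s (y k) +
        n k * frameTrace h β (fun y => ‖P y‖ ^ 2) (y k) := by
      filter_upwards [hyint] with k hk
      have hb := hball (Metric.ball_subset_closedBall hk)
      have hfy : ContDiffAt ℝ 2 f (y k) := hb.2.2.2
      have hsy : ContDiffAt ℝ 2 s (y k) := hs.contDiffAt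
      have h1 : ContDiffAt ℝ 2 (fun y => f y + δ * s y) (y k) := hfy.add (contDiffAt_const.mul hsy)
      have h2 : ContDiffAt ℝ 2 (fun y => (n k : ℝ) * ‖P y‖ ^ 2) (y k) :=
        contDiffAt_const.mul hq.contDiffAt
      -- The maximum point lies in the open ball, so the penalised function is a genuine local test
      -- function there.
      have h3 := hb.2.1 (fun z => f z + δ * s z + n k * ‖P z‖ ^ 2 + c k)
        ((h1.add h2).add contDiffAt_const)
        ((Metric.isOpen_ball.mem_nhds hk |> fun hm => eventually_of_mem hm fun z hz =>
          (hmax k).2.2 z (Metric.ball_subset_closedBall hz))) (hmax k).2.1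
      rwa [frameTrace_add (h1.add h2) contDiffAt_const, frameTrace_const, add_zero,
        frameTrace_add h1 h2, frameTrace_add hfy (contDiffAt_const.mul hsy),
        frameTrace_const_mul δ hsy, frameTrace_const_mul _ hq.contDiffAt] at h3
    -- The penalty contributes `n · O(‖P y‖²)`, which tends to `0` together with `n ‖P y‖²`.
    have hO := (frameTrace_norm_sq_isBigO hh hi hβ hdet hQ hC htan hflat).comp_tendsto hy
    have hO' : (fun k => (n k : ℝ) * frameTrace h β (fun y => ‖P y‖ ^ 2) (y k)) =O[atTop]
        fun k => (n k : ℝ) * ‖P (y k)‖ ^ 2 := (isBigO_refl _ _).mul hO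
    have hlim := (((continuousAt_frameTrace hh hi hβ hdet hf).tendsto.comp hy).add
      (((continuousAt_frameTrace hh hi hβ hdet hs.contDiffAt).tendsto.comp hy).const_mul δ)).add
      (hO'.trans_tendsto hnq)
    rw [add_zero] at hlim
    exact ge_of_tendsto hlim hnonneg
  have hlim : Tendsto (fun δ : ℝ => frameTrace h β f y₀ + δ * frameTrace h β s y₀) (𝓝[>] 0)
      (𝓝 (frameTrace h β f y₀ + 0 * frameTrace h β s y₀)) :=
    ((continuous_const.add (continuous_id.mul continuous_const)).tendsto 0).mono_left
      nhdsWithin_le_nhds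
  rw [zero_mul, add_zero] at hlim
  exact ge_of_tendsto hlim (eventually_mem_nhdsWithin.mono fun δ hδ => key δ hδ)

end FrameTrace

end Local

/-! ### Differentials and metrics read in model spaces -/

section Differential

variable {E : Type*} [NormedAddCommGroup E] [NormedSpace ℝ E]
  {Z : Type*} [TopologicalSpace Z] [ChartedSpace E Z]
  {F : Type*} [NormedAddCommGroup F] [NormedSpace ℝ F]
  {X : Type*} [TopologicalSpace X] [ChartedSpace F X]

/-- The expression of a metric on `Z` in a parametrization `f`. -/
noncomputable def localMetric (g : BilinearField E Z) (f : F → Z) (y : F) : F →L[ℝ] F →L[ℝ] ℝ :=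
  pullbackMetric (F := F) (X := F) f g y

/-- The differential of `f` at `x`, as a map between the model spaces. -/
noncomputable def modelDeriv (f : X → Z) (x : X) : F →L[ℝ] E :=
  mfderiv 𝓘(ℝ, F) 𝓘(ℝ, E) f x

/-- The value at `z` of a field of bilinear forms, as a form on the model space. -/
def modelForm (g : BilinearField E Z) (z : Z) : E →L[ℝ] E →L[ℝ] ℝ := g z

section Deriv

variable {G : Type*} [NormedAddCommGroup G] [NormedSpace ℝ G]
  {Y : Type*} [TopologicalSpace Y] [ChartedSpace G Y]

theorem modelDeriv_comp {f : X → Z} {c : Y → X} {y : Y}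
    (hf : MDifferentiableAt 𝓘(ℝ, F) 𝓘(ℝ, E) f (c y))
    (hc : MDifferentiableAt 𝓘(ℝ, G) 𝓘(ℝ, F) c y) :
    modelDeriv (F := G) (E := E) (f ∘ c) y =
      (modelDeriv (F := F) (E := E) f (c y)).comp (modelDeriv (F := G) (E := F) c y) :=
  mfderiv_comp y hf hc

theorem modelDeriv_congr {f f' : X → Z} {x : X} (h : f =ᶠ[𝓝 x] f') :
    modelDeriv (F := F) (E := E) f x = modelDeriv (F := F) (E := E) f' x :=
  h.mfderiv_eq

end Deriv

theorem modelDeriv_eq_fderiv (f : F → E) (y : F) : modelDeriv (F := F) (E := E) f y = fderiv ℝ f y :=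
  mfderiv_eq_fderiv

theorem localMetric_apply (g : BilinearField E Z) (f : F → Z) (y v w : F) :
    localMetric g f y v w = modelForm g (f y) (modelDeriv (F := F) (E := E) f y v)
      (modelDeriv (F := F) (E := E) f y w) := rfl

/-- Transformation of the expression of a metric under a change of the parametrization. -/
theorem localMetric_comp (g : BilinearField E Z) {G : Type*} [NormedAddCommGroup G]
    [NormedSpace ℝ G] {f : F → Z} {f' : G → Z} {c : G → F} {y : G} (h : f' =ᶠ[𝓝 y] f ∘ c)
    (hf : MDifferentiableAt 𝓘(ℝ, F) 𝓘(ℝ, E) f (c y)) (hc : DifferentiableAt ℝ c y) (v w : G) :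
    localMetric g f' y v w = localMetric g f (c y) (fderiv ℝ c y v) (fderiv ℝ c y w) := by
  rw [localMetric_apply, localMetric_apply, modelDeriv_congr h,
    modelDeriv_comp hf hc.mdifferentiableAt, h.eq_of_nhds, modelDeriv_eq_fderiv]
  rfl

section Chart

variable {χ : OpenPartialHomeomorph Z E}

theorem mdifferentiableAt_chart (hχ : χ ∈ IsManifold.maximalAtlas 𝓘(ℝ, E) ∞ Z) {z : Z}
    (hz : z ∈ χ.source) : MDifferentiableAt 𝓘(ℝ, E) 𝓘(ℝ, E) χ z :=
  (contMDiffAt_of_mem_maximalAtlas hχ hz).mdifferentiableAt (by simp)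

theorem mdifferentiableAt_chart_symm (hχ : χ ∈ IsManifold.maximalAtlas 𝓘(ℝ, E) ∞ Z) {y : E}
    (hy : y ∈ χ.target) : MDifferentiableAt 𝓘(ℝ, E) 𝓘(ℝ, E) χ.symm y :=
  (contMDiffAt_symm_of_mem_maximalAtlas hχ hy).mdifferentiableAt (by simp)

theorem modelDeriv_chart_symm_chart (hχ : χ ∈ IsManifold.maximalAtlas 𝓘(ℝ, E) ∞ Z) {y : E}
    (hy : y ∈ χ.target) (v : E) :
    modelDeriv (F := E) (E := E) χ (χ.symm y) (modelDeriv (F := E) (E := E) χ.symm y v) = v := by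
  have h1 : (χ ∘ χ.symm : E → E) =ᶠ[𝓝 y] id :=
    Filter.eventuallyEq_of_mem (χ.open_target.mem_nhds hy) fun z hz => χ.right_inv hz
  have h2 := modelDeriv_comp (mdifferentiableAt_chart hχ (χ.map_target hy))
    (mdifferentiableAt_chart_symm hχ hy)
  rw [modelDeriv_congr h1, modelDeriv_eq_fderiv, fderiv_id] at h2
  exact (congrArg (fun L : E →L[ℝ] E => L v) h2).symm

theorem modelDeriv_symm_chart_chart (hχ : χ ∈ IsManifold.maximalAtlas 𝓘(ℝ, E) ∞ Z) {z : Z}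
    (hz : z ∈ χ.source) (v : E) :
    modelDeriv (F := E) (E := E) χ.symm (χ z) (modelDeriv (F := E) (E := E) χ z v) = v := by
  have h1 : (χ.symm ∘ χ : Z → Z) =ᶠ[𝓝 z] id :=
    Filter.eventuallyEq_of_mem (χ.open_source.mem_nhds hz) fun z hz => χ.left_inv hz
  have h2 := modelDeriv_comp (mdifferentiableAt_chart_symm hχ (χ.map_source hz))
    (mdifferentiableAt_chart hχ hz)
  rw [modelDeriv_congr h1] at h2
  have h3 : modelDeriv (F := E) (E := E) (id : Z → Z) z = ContinuousLinearMap.id ℝ E := mfderiv_id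
  rw [h3] at h2
  exact (congrArg (fun L : E →L[ℝ] E => L v) h2).symm

theorem contDiffAt_comp_chart_symm (hχ : χ ∈ IsManifold.maximalAtlas 𝓘(ℝ, E) ∞ Z) {z : Z}
    (hz : z ∈ χ.source) {n : ℕ} {φ : Z → ℝ} (hφ : ContMDiffAt 𝓘(ℝ, E) 𝓘(ℝ, ℝ) n φ z) :
    ContDiffAt ℝ n (φ ∘ χ.symm) (χ z) := by
  have h1 := (contMDiffAt_symm_of_mem_maximalAtlas hχ (χ.map_source hz)).of_le
    (show (n : WithTop ℕ∞) ≤ ∞ by exact_mod_cast le_top)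
  exact (ContMDiffAt.comp (χ z) (by rwa [χ.left_inv hz]) h1).contDiffAt

end Chart

end Differential

/-! ### Riemannian metrics and Hessians in arbitrary charts -/

section Metric

variable {E : Type*} [NormedAddCommGroup E] [NormedSpace ℝ E]
  {Z : Type*} [TopologicalSpace Z] [ChartedSpace E Z] [IsManifold 𝓘(ℝ, E) ∞ Z]
  {F : Type*} [NormedAddCommGroup F] [NormedSpace ℝ F]
  {X : Type*} [TopologicalSpace X] [ChartedSpace F X] [IsManifold 𝓘(ℝ, F) ∞ X]

theorem contMDiffAt_tangentMap {f : X → Z} {s : Set X} (hs : IsOpen s)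
    (hf : ContMDiffOn 𝓘(ℝ, F) 𝓘(ℝ, E) ∞ f s) {v : TangentBundle 𝓘(ℝ, F) X} (hv : v.proj ∈ s) :
    ContMDiffAt 𝓘(ℝ, F).tangent 𝓘(ℝ, E).tangent ∞ (tangentMap 𝓘(ℝ, F) 𝓘(ℝ, E) f) v := by
  have hopen : IsOpen (TotalSpace.proj ⁻¹' s : Set (TangentBundle 𝓘(ℝ, F) X)) :=
    hs.preimage (FiberBundle.continuous_proj F (TangentSpace 𝓘(ℝ, F) (M := X)))
  refine ((hf.contMDiffOn_tangentMapWithin (m := ∞) (by simp) hs.uniqueMDiffOn).contMDiffAt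
    (hopen.mem_nhds hv)).congr_of_eventuallyEq ?_
  filter_upwards [hopen.mem_nhds hv] with w hw
  rw [tangentMap, tangentMapWithin, mfderivWithin_of_isOpen hs hw]

theorem contMDiffAt_tangentBundle_vectorSpace {n : WithTop ℕ∞} {V : F → F} {y : F}
    (hV : ContDiffAt ℝ n V y) : ContMDiffAt 𝓘(ℝ, F) 𝓘(ℝ, F).tangent n
      (fun y : F => (⟨y, V y⟩ : TangentBundle 𝓘(ℝ, F) F)) y :=
  contMDiffAt_vectorSpace_iff_contDiffAt.2 hV

/-- In coordinates, a metric is given by a smooth field of bilinear forms. -/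
theorem contDiffAt_localMetric [FiniteDimensional ℝ F]
    (g : ContMDiffRiemannianMetric 𝓘(ℝ, E) ∞ E (fun z : Z => TangentSpace 𝓘(ℝ, E) z))
    {f : F → Z} {s : Set F} (hs : IsOpen s) (hf : ContMDiffOn 𝓘(ℝ, F) 𝓘(ℝ, E) ∞ f s)
    {y : F} (hy : y ∈ s) : ContDiffAt ℝ ∞ (localMetric g.inner f) y := by
  refine contDiffAt_clm_of_apply fun v => contDiffAt_clm_of_apply fun w => ?_
  have hfy : ContMDiffAt 𝓘(ℝ, F) 𝓘(ℝ, E) ∞ f y := hf.contMDiffAt (hs.mem_nhds hy)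
  have hg := (g.contMDiff (f y)).comp y hfy
  have hv : ∀ v : F, ContMDiffAt 𝓘(ℝ, F) 𝓘(ℝ, E).tangent ∞
      (fun y => (⟨f y, mfderiv 𝓘(ℝ, F) 𝓘(ℝ, E) f y v⟩ : TangentBundle 𝓘(ℝ, E) Z)) y := fun v =>
    (contMDiffAt_tangentMap hs hf (v := ⟨y, v⟩) hy).comp y
      (contMDiffAt_tangentBundle_vectorSpace contDiffAt_const)
  have := ContMDiffAt.clm_bundle_apply₂ (F₁ := E) (F₂ := E) (F₃ := ℝ) (E₃ := Bundle.Trivial Z ℝ)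
    hg (hv v) (hv w)
  rw [contMDiffAt_totalSpace] at this
  exact this.2.contDiffAt

theorem isInnerProduct_localMetric
    (g : ContMDiffRiemannianMetric 𝓘(ℝ, E) ∞ E (fun z : Z => TangentSpace 𝓘(ℝ, E) z))
    {f : F → Z} {y : F} (hinj : Function.Injective (differential (E := E) (F := F) f y)) :
    IsInnerProduct (localMetric g.inner f y) where
  symm _ _ := g.symm _ _ _
  pos _ hv := g.pos _ _ fun h => hv (hinj (h.trans (map_zero _).symm))

section Chart

variable {χ : OpenPartialHomeomorph Z E}

variable (g : ContMDiffRiemannianMetric 𝓘(ℝ, E) ∞ E (fun z : Z => TangentSpace 𝓘(ℝ, E) z))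

theorem contDiffAt_localMetric_chart [FiniteDimensional ℝ E]
    (hχ : χ ∈ IsManifold.maximalAtlas 𝓘(ℝ, E) ∞ Z) {y : E} (hy : y ∈ χ.target) :
    ContDiffAt ℝ ∞ (localMetric g.inner χ.symm) y :=
  contDiffAt_localMetric g χ.open_target (contMDiffOn_symm_of_mem_maximalAtlas hχ) hy

theorem isInnerProduct_localMetric_chart (hχ : χ ∈ IsManifold.maximalAtlas 𝓘(ℝ, E) ∞ Z) {y : E}
    (hy : y ∈ χ.target) : IsInnerProduct (localMetric g.inner χ.symm y) :=
  isInnerProduct_localMetric g fun v w hvw => by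
    rw [← modelDeriv_chart_symm_chart hχ hy v, ← modelDeriv_chart_symm_chart hχ hy w]
    exact congrArg (modelDeriv (F := E) (E := E) χ (χ.symm y)) hvw

/-- The Hessian may be computed in any chart. -/
theorem hessian_eq_localHessian [FiniteDimensional ℝ E]
    (hχ : χ ∈ IsManifold.maximalAtlas 𝓘(ℝ, E) ∞ Z) {z : Z} (hz : z ∈ χ.source) {φ : Z → ℝ}
    (hφ : ContMDiffAt 𝓘(ℝ, E) 𝓘(ℝ, ℝ) 2 φ z) (v w : E) :
    hessian g.inner φ z v w = localHessian (localMetric g.inner χ.symm) (φ ∘ χ.symm) (χ z)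
      (modelDeriv (F := E) (E := E) χ z v) (modelDeriv (F := E) (E := E) χ z w) := by
  set ψ := chartAt E z with hψdef
  have hψ : ψ ∈ IsManifold.maximalAtlas 𝓘(ℝ, E) ∞ Z := IsManifold.chart_mem_maximalAtlas z
  have hzψ : z ∈ ψ.source := mem_chart_source E z
  -- By definition the preferred chart at `z` is used, which varies with `z`; the passage to the
  -- fixed chart `χ` is `localHessian_comp` for the transition map.
  have h0 : hessian g.inner φ z v w = localHessian (localMetric g.inner ψ.symm) (φ ∘ ψ.symm) (ψ z)
      (modelDeriv (F := E) (E := E) ψ z v) (modelDeriv (F := E) (E := E) ψ z w) := rfl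
  have hsymm : ψ.symm (ψ z) = z := ψ.left_inv hzψ
  have hev : ∀ᶠ y in 𝓝 (ψ z), y ∈ ψ.target ∧ ψ.symm y ∈ χ.source := by
    have h1 : ψ.target ∈ 𝓝 (ψ z) := ψ.open_target.mem_nhds (ψ.map_source hzψ)
    have h2 : ∀ᶠ y in 𝓝 (ψ z), ψ.symm y ∈ χ.source :=
      (ψ.continuousAt_symm (ψ.map_source hzψ)).eventually_mem
        (by rw [hsymm]; exact χ.open_source.mem_nhds hz)
    exact Filter.Eventually.and h1 h2
  let c : E → E := χ ∘ ψ.symm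
  have hcz : c (ψ z) = χ z := congrArg χ hsymm
  have hc : ∀ y, y ∈ ψ.target → ψ.symm y ∈ χ.source → ContDiffAt ℝ ∞ c y := fun y h1 h2 =>
    ((contMDiffAt_of_mem_maximalAtlas hχ h2).comp y
      (contMDiffAt_symm_of_mem_maximalAtlas hψ h1)).contDiffAt
  have hca := hc _ hev.self_of_nhds.1 hev.self_of_nhds.2
  have hDc : fderiv ℝ c (ψ z) = (modelDeriv (F := E) (E := E) χ z).comp
      (modelDeriv (F := E) (E := E) ψ.symm (ψ z)) := by
    rw [← modelDeriv_eq_fderiv, modelDeriv_comp (by rw [hsymm]; exact mdifferentiableAt_chart hχ hz)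
      (mdifferentiableAt_chart_symm hψ (ψ.map_source hzψ)), hsymm]
  have hDc' : ∀ v, fderiv ℝ c (ψ z) (modelDeriv (F := E) (E := E) ψ z v) =
      modelDeriv (F := E) (E := E) χ z v := fun v => by
    rw [hDc, ContinuousLinearMap.comp_apply, modelDeriv_symm_chart_chart hψ hzψ]
  have hφ' : ContDiffAt ℝ 2 (φ ∘ χ.symm) (c (ψ z)) :=
    hcz ▸ contDiffAt_comp_chart_symm hχ hz (n := 2) hφ
  have hφc : φ ∘ ψ.symm =ᶠ[𝓝 (ψ z)] (φ ∘ χ.symm) ∘ c := by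
    filter_upwards [hev] with y hy
    simp [c, χ.left_inv hy.2]
  have hsurj : Function.Surjective (fderiv ℝ c (ψ z)) := fun w => by
    refine ⟨modelDeriv (F := E) (E := E) ψ z (modelDeriv (F := E) (E := E) χ.symm (χ z) w), ?_⟩
    rw [hDc']
    have := modelDeriv_chart_symm_chart hχ (χ.map_source hz) w
    rwa [χ.left_inv hz] at this
  have hc2 : ContDiffAt ℝ 2 c (ψ z) := hca.of_le ENat.LEInfty.out
  rw [h0, localHessian_congr Filter.EventuallyEq.rfl hφc,
    localHessian_comp (h := localMetric g.inner χ.symm) hc2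
    ((contDiffAt_localMetric_chart g hχ (hcz ▸ χ.map_source hz)).differentiableAt (by simp))
    ((contDiffAt_localMetric_chart g hψ (ψ.map_source hzψ)).differentiableAt (by simp))
    ?_ (isInnerProduct_localMetric_chart g hχ (hcz ▸ χ.map_source hz))
    (isInnerProduct_localMetric_chart g hψ (ψ.map_source hzψ)) hφ' hsurj, hDc', hDc', hcz]
  filter_upwards [hev.eventually_nhds] with y hy s t
  refine localMetric_comp g.inner ?_ ?_ ((hc y hy.self_of_nhds.1 hy.self_of_nhds.2).differentiableAt
    (by simp)) s t
  · filter_upwards [hy] with y' hy'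
    exact (χ.left_inv hy'.2).symm
  · exact mdifferentiableAt_chart_symm hχ (χ.map_source hy.self_of_nhds.2)

end Chart

end Metric

/-! ### Hessians of restrictions and the second fundamental form -/

section Restriction

variable {E : Type*} [NormedAddCommGroup E] [NormedSpace ℝ E] [FiniteDimensional ℝ E]
  {Z : Type*} [TopologicalSpace Z] [ChartedSpace E Z] [IsManifold 𝓘(ℝ, E) ∞ Z]
  {F : Type*} [NormedAddCommGroup F] [NormedSpace ℝ F] [FiniteDimensional ℝ F]
  {X : Type*} [TopologicalSpace X] [ChartedSpace F X] [IsManifold 𝓘(ℝ, F) ∞ X]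

/-- Over a plane tangent to a submanifold on which the trace of the second fundamental form
vanishes, the traces of the Hessians of a function and of its restriction agree. -/
theorem sum_hessian_comp
    (g : ContMDiffRiemannianMetric 𝓘(ℝ, E) ∞ E (fun z : Z => TangentSpace 𝓘(ℝ, E) z))
    {i : X → Z} (hi : ContMDiff 𝓘(ℝ, F) 𝓘(ℝ, E) ∞ i) {x : X}
    (hinj : Function.Injective (modelDeriv (F := F) (E := E) i x)) {ι : Type*} [Fintype ι]
    {e : ι → F} (hB : ∑ j, secondFundamentalForm (F := F) g.inner i x (e j) (e j) = 0)
    {f : Z → ℝ} (hf : ContMDiffAt 𝓘(ℝ, E) 𝓘(ℝ, ℝ) 2 f (i x)) :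
    ∑ j, hessian (pullbackMetric (F := F) i g.inner) (f ∘ i) x (e j) (e j) =
      ∑ j, hessian g.inner f (i x) (modelDeriv (F := F) (E := E) i x (e j))
        (modelDeriv (F := F) (E := E) i x (e j)) := by
  set ψ := chartAt F x with hψdef
  set χ := chartAt E (i x) with hχdef
  have hψ : ψ ∈ IsManifold.maximalAtlas 𝓘(ℝ, F) ∞ X := IsManifold.chart_mem_maximalAtlas x
  have hχ : χ ∈ IsManifold.maximalAtlas 𝓘(ℝ, E) ∞ Z := IsManifold.chart_mem_maximalAtlas (i x)
  have hx : x ∈ ψ.source := mem_chart_source F x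
  have hix : i x ∈ χ.source := mem_chart_source E (i x)
  have hsymm : ψ.symm (ψ x) = x := ψ.left_inv hx
  let c : F → E := χ ∘ i ∘ ψ.symm
  have hca : c (ψ x) = χ (i x) := by simp [c, hsymm]
  have hev : ∀ᶠ y in 𝓝 (ψ x), y ∈ ψ.target ∧ i (ψ.symm y) ∈ χ.source := by
    have h1 : ψ.target ∈ 𝓝 (ψ x) := ψ.open_target.mem_nhds (ψ.map_source hx)
    have h2 : ContinuousAt (fun y => i (ψ.symm y)) (ψ x) :=
      hi.continuous.continuousAt.comp (ψ.continuousAt_symm (ψ.map_source hx))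
    exact Filter.Eventually.and h1 (h2.eventually_mem (by
      simp only [hsymm]; exact χ.open_source.mem_nhds hix))
  have hic : ∀ y ∈ ψ.target, ContMDiffAt 𝓘(ℝ, F) 𝓘(ℝ, E) ∞ (i ∘ ψ.symm) y := fun y hy =>
    hi.contMDiffAt.comp y (contMDiffAt_symm_of_mem_maximalAtlas hψ hy)
  have hc : ∀ y, y ∈ ψ.target → i (ψ.symm y) ∈ χ.source → ContDiffAt ℝ ∞ c y := fun y h1 h2 =>
    (ContMDiffAt.comp y (contMDiffAt_of_mem_maximalAtlas hχ h2) (hic y h1)).contDiffAt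
  have hc2 : ContDiffAt ℝ 2 c (ψ x) := (hc _ hev.self_of_nhds.1 hev.self_of_nhds.2).of_le
    ENat.LEInfty.out
  have hdi : ∀ x, MDifferentiableAt 𝓘(ℝ, F) 𝓘(ℝ, E) i x := fun x =>
    hi.contMDiffAt.mdifferentiableAt (by simp)
  have hDi : ∀ y ∈ ψ.target, modelDeriv (F := F) (E := E) (i ∘ ψ.symm) y =
      (modelDeriv (F := F) (E := E) i (ψ.symm y)).comp (modelDeriv (F := F) (E := F) ψ.symm y) :=
    fun y hy => modelDeriv_comp (hdi _) (mdifferentiableAt_chart_symm hψ hy)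
  have hDc : ∀ v, fderiv ℝ c (ψ x) (modelDeriv (F := F) (E := F) ψ x v) =
      modelDeriv (F := E) (E := E) χ (i x) (modelDeriv (F := F) (E := E) i x v) := by
    intro v
    have h1 : modelDeriv (F := F) (E := E) c (ψ x) = (modelDeriv (F := E) (E := E) χ (i x)).comp
        (modelDeriv (F := F) (E := E) (i ∘ ψ.symm) (ψ x)) := by
      have := modelDeriv_comp (F := E) (E := E) (G := F) (f := χ) (c := i ∘ ψ.symm) (y := ψ x)
        (by simp only [Function.comp_apply, hsymm]; exact mdifferentiableAt_chart hχ hix)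
        ((hic _ (ψ.map_source hx)).mdifferentiableAt (by simp))
      simpa only [Function.comp_apply, hsymm] using this
    rw [← modelDeriv_eq_fderiv, h1, hDi _ (ψ.map_source hx), hsymm]
    simp only [ContinuousLinearMap.comp_apply]
    rw [modelDeriv_symm_chart_chart hψ hx]
  let a : ι → E := fun j =>
    fderiv ℝ (fderiv ℝ c) (ψ x) (modelDeriv (F := F) (E := F) ψ x (e j))
        (modelDeriv (F := F) (E := F) ψ x (e j)) +
      christoffel (localMetric g.inner χ.symm) (χ (i x))
        (fderiv ℝ c (ψ x) (modelDeriv (F := F) (E := F) ψ x (e j)))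
        (fderiv ℝ c (ψ x) (modelDeriv (F := F) (E := F) ψ x (e j)))
  -- Only the shape of `B` matters: the covariant derivative minus some vector in the range of the
  -- differential of `i`. Thus a vanishing trace makes the sum of covariant derivatives tangential.
  have htan : ∀ j, ∃ t : F, (secondFundamentalForm (F := F) g.inner i x (e j) (e j) : E) =
      modelDeriv (F := E) (E := E) χ.symm (χ (i x)) (a j) -
      modelDeriv (F := F) (E := E) i x t := fun j => ⟨_, rfl⟩
  choose t ht using htan
  have he : ∃ s, ∑ j, (fderiv ℝ (fderiv ℝ c) (ψ x) (modelDeriv (F := F) (E := F) ψ x (e j))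
          (modelDeriv (F := F) (E := F) ψ x (e j)) +
        christoffel (localMetric g.inner χ.symm) (c (ψ x))
          (fderiv ℝ c (ψ x) (modelDeriv (F := F) (E := F) ψ x (e j)))
          (fderiv ℝ c (ψ x) (modelDeriv (F := F) (E := F) ψ x (e j)))) = fderiv ℝ c (ψ x) s := by
    refine ⟨modelDeriv (F := F) (E := F) ψ x (∑ j, t j), ?_⟩
    rw [hDc, hca]
    have hB' : ∑ j, (modelDeriv (F := E) (E := E) χ.symm (χ (i x)) (a j) -
        modelDeriv (F := F) (E := E) i x (t j)) = 0 :=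
      (Finset.sum_congr rfl fun j _ => (ht j).symm).trans hB
    rw [Finset.sum_sub_distrib, ← map_sum, ← map_sum, sub_eq_zero] at hB'
    rw [← hB']
    have := modelDeriv_chart_symm_chart hχ (χ.map_source hix)
    rw [χ.left_inv hix] at this
    exact (this _).symm
  have hχX : localMetric (pullbackMetric (F := F) i g.inner) ψ.symm =ᶠ[𝓝 (ψ x)]
      localMetric g.inner (i ∘ ψ.symm) := by
    filter_upwards [ψ.open_target.mem_nhds (ψ.map_source hx)] with y hy
    ext v w
    rw [localMetric_apply g.inner, hDi y hy]
    rfl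
  have hφc : (f ∘ i) ∘ ψ.symm =ᶠ[𝓝 (ψ x)] (f ∘ χ.symm) ∘ c := by
    filter_upwards [hev] with y hy
    simp [c, χ.left_inv hy.2]
  have hinj' : Function.Injective (differential (E := E) (F := F) (i ∘ ψ.symm) (ψ x)) := by
    suffices h : ∀ v w : F, modelDeriv (F := F) (E := E) (i ∘ ψ.symm) (ψ x) v =
        modelDeriv (F := F) (E := E) (i ∘ ψ.symm) (ψ x) w → v = w from fun v w => h v w
    intro v w h1
    rw [hDi _ (ψ.map_source hx), hsymm] at h1
    have h2 : modelDeriv (F := F) (E := F) ψ.symm (ψ x) v =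
      modelDeriv (F := F) (E := F) ψ.symm (ψ x) w := hinj h1
    rw [← modelDeriv_chart_symm_chart hψ (ψ.map_source hx) v, h2,
      modelDeriv_chart_symm_chart hψ (ψ.map_source hx)]
  calc ∑ j, hessian (pullbackMetric (F := F) i g.inner) (f ∘ i) x (e j) (e j)
      = ∑ j, localHessian (localMetric g.inner (i ∘ ψ.symm)) ((f ∘ χ.symm) ∘ c) (ψ x)
          (modelDeriv (F := F) (E := F) ψ x (e j)) (modelDeriv (F := F) (E := F) ψ x (e j)) :=
        Finset.sum_congr rfl fun j _ => localHessian_congr hχX hφc _ _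
    _ = ∑ j, localHessian (localMetric g.inner χ.symm) (f ∘ χ.symm) (c (ψ x))
          (fderiv ℝ c (ψ x) (modelDeriv (F := F) (E := F) ψ x (e j)))
          (fderiv ℝ c (ψ x) (modelDeriv (F := F) (E := F) ψ x (e j))) := by
        refine sum_localHessian_comp hc2
          ((contDiffAt_localMetric_chart g hχ (hca ▸ χ.map_source hix)).differentiableAt (by simp))
          ((contDiffAt_localMetric g ψ.open_target
            (fun y hy => (hic y hy).contMDiffWithinAt) (ψ.map_source hx)).differentiableAt (by simp))
          ?_ (isInnerProduct_localMetric_chart g hχ (hca ▸ χ.map_source hix))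
          (isInnerProduct_localMetric g hinj') ?_ _ he
        · filter_upwards [hev.eventually_nhds] with y hy v w
          refine localMetric_comp g.inner ?_ ?_ ((hc y hy.self_of_nhds.1
            hy.self_of_nhds.2).differentiableAt (by simp)) v w
          · filter_upwards [hy] with y' hy'
            exact (χ.left_inv hy'.2).symm
          · exact mdifferentiableAt_chart_symm hχ (χ.map_source hy.self_of_nhds.2)
        · rw [hca]
          exact contDiffAt_comp_chart_symm hχ hix (n := 2) hf
    _ = _ := by
        refine Finset.sum_congr rfl fun j _ => ?_
        rw [hca, hDc]
        rfl

end Restriction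

/-! ### Frames of plane fields and their extension to the ambient manifold -/

section Frames

variable {E : Type*} [NormedAddCommGroup E] [NormedSpace ℝ E]
  {Z : Type*} [TopologicalSpace Z] [ChartedSpace E Z]
  {F : Type*} [NormedAddCommGroup F] [NormedSpace ℝ F]
  {X : Type*} [TopologicalSpace X] [ChartedSpace F X] {p : ℕ}

/-- A tangent plane as a subspace of the model space. -/
def TangentPlane.modelPlane (ξ : TangentPlane E Z p) : Submodule ℝ E := ξ.plane

/-- A tuple of tangent vectors as a tuple of vectors of the model space. -/
def modelTuple (A : Tuples E Z p) : EuclideanSpace ℝ (Fin p) →L[ℝ] E := A.2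

/-- The tuple of tangent vectors at `z` given by a tuple of vectors of the model space. -/
def tupleAt (z : Z) (L : EuclideanSpace ℝ (Fin p) →L[ℝ] E) : Tuples E Z p := ⟨z, L⟩

theorem TangentPlane.ext_model {ξ ξ' : TangentPlane E Z p} (hb : ξ.base = ξ'.base)
    (hp : ξ.modelPlane = ξ'.modelPlane) : ξ = ξ' := by
  obtain ⟨z, W, hW⟩ := ξ
  obtain ⟨z', W', hW'⟩ := ξ'
  obtain rfl : z = z' := hb
  obtain rfl : W = W' := hp
  rfl

theorem isFrameOf_iff {A : Tuples E Z p} {ξ : TangentPlane E Z p} :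
    IsFrameOf A ξ ↔ A.1 = ξ.base ∧ Function.Injective (modelTuple A) ∧
      LinearMap.range (modelTuple A).toLinearMap = ξ.modelPlane := by
  constructor
  · rintro ⟨h, rfl⟩
    exact ⟨rfl, h, rfl⟩
  · rintro ⟨h1, h2, h3⟩
    exact ⟨h2, TangentPlane.ext_model h1 h3⟩

theorem mem_tangentPlanes_iff {f : X → Z} {𝒢 : Set (TangentPlane E Z p)} {η : TangentPlane F X p} :
    η ∈ tangentPlanes f 𝒢 ↔ ∃ ξ ∈ 𝒢, ξ.base = f η.base ∧
      ξ.modelPlane = η.modelPlane.map (modelDeriv (F := F) (E := E) f η.base).toLinearMap := by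
  constructor
  · rintro ⟨ξ, hξ, h, rfl⟩
    exact ⟨_, hξ, rfl, rfl⟩
  · rintro ⟨ξ, hξ, h1, h2⟩
    have h3 : finrank ℝ (η.modelPlane.map (modelDeriv (F := F) (E := E) f η.base).toLinearMap) = p :=
      h2 ▸ ξ.finrank_eq
    exact ⟨ξ, hξ, h3, TangentPlane.ext_model h1.symm h2.symm⟩

theorem isFrameOf_tupleAt_of_eq {A : Tuples E Z p} {ξ : TangentPlane E Z p} {z : Z}
    {L : EuclideanSpace ℝ (Fin p) →L[ℝ] E} (hz : A.1 = z) (hL : modelTuple A = L)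
    (h : IsFrameOf A ξ) : IsFrameOf (tupleAt z L) ξ := by
  rw [isFrameOf_iff] at h ⊢
  exact ⟨hz.symm.trans h.1, by rw [hL] at h; exact h.2⟩

theorem injective_modelDeriv_chart {χ : OpenPartialHomeomorph Z E}
    (hχ : χ ∈ IsManifold.maximalAtlas 𝓘(ℝ, E) ∞ Z) {z : Z} (hz : z ∈ χ.source) :
    Function.Injective (modelDeriv (F := E) (E := E) χ z) :=
  Function.LeftInverse.injective (modelDeriv_symm_chart_chart hχ hz)

theorem injective_modelDeriv_chart_symm {χ : OpenPartialHomeomorph Z E}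
    (hχ : χ ∈ IsManifold.maximalAtlas 𝓘(ℝ, E) ∞ Z) {y : E} (hy : y ∈ χ.target) :
    Function.Injective (modelDeriv (F := E) (E := E) χ.symm y) :=
  Function.LeftInverse.injective (modelDeriv_chart_symm_chart hχ hy)

/-- Chain rule for `χ ∘ i = J ∘ ψ`. -/
theorem modelDeriv_chart_comp_immersion {χ : OpenPartialHomeomorph Z E}
    (hχ : χ ∈ IsManifold.maximalAtlas 𝓘(ℝ, E) ∞ Z) {ψ : OpenPartialHomeomorph X F}
    (hψ : ψ ∈ IsManifold.maximalAtlas 𝓘(ℝ, F) ∞ X) {i : X → Z}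
    (hi : ContMDiff 𝓘(ℝ, F) 𝓘(ℝ, E) ∞ i) {J : F →L[ℝ] E}
    (hJ : ∀ x ∈ ψ.source, i x ∈ χ.source ∧ χ (i x) = J (ψ x)) {x : X} (hx : x ∈ ψ.source) :
    (modelDeriv (F := E) (E := E) χ (i x)).comp (modelDeriv (F := F) (E := E) i x) =
      J.comp (modelDeriv (F := F) (E := F) ψ x) := by
  rw [← modelDeriv_comp (mdifferentiableAt_chart hχ (hJ x hx).1)
    (hi.contMDiffAt.mdifferentiableAt (by simp))]
  have h1 : χ ∘ i =ᶠ[𝓝 x] J ∘ ψ :=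
    Filter.eventuallyEq_of_mem (ψ.open_source.mem_nhds hx) fun x' hx' => (hJ x' hx').2
  rw [modelDeriv_congr h1, modelDeriv_comp (F := F) J.mdifferentiableAt
    (mdifferentiableAt_chart hψ hx), modelDeriv_eq_fderiv, ContinuousLinearMap.fderiv]

theorem injective_modelDeriv_immersion {χ : OpenPartialHomeomorph Z E}
    (hχ : χ ∈ IsManifold.maximalAtlas 𝓘(ℝ, E) ∞ Z) {ψ : OpenPartialHomeomorph X F}
    (hψ : ψ ∈ IsManifold.maximalAtlas 𝓘(ℝ, F) ∞ X) {i : X → Z}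
    (hi : ContMDiff 𝓘(ℝ, F) 𝓘(ℝ, E) ∞ i) {J : F →L[ℝ] E} (hJi : Function.Injective J)
    (hJ : ∀ x ∈ ψ.source, i x ∈ χ.source ∧ χ (i x) = J (ψ x)) {x : X} (hx : x ∈ ψ.source) :
    Function.Injective (modelDeriv (F := F) (E := E) i x) := by
  have h := hJi.comp (injective_modelDeriv_chart hψ hx)
  rw [← ContinuousLinearMap.coe_comp, ← modelDeriv_chart_comp_immersion hχ hψ hi hJ hx,
    ContinuousLinearMap.coe_comp] at h
  exact h.of_comp

variable [IsManifold 𝓘(ℝ, E) ∞ Z] {G : Type*} [NormedAddCommGroup G] [NormedSpace ℝ G]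

/-- Evaluated on a fixed vector, the tuple is a smooth curve of tangent vectors, or more generally a
smooth map to `TZ`; the tangent map of `χ` then makes its components smooth. -/
theorem contDiffAt_modelTuple {χ : OpenPartialHomeomorph Z E}
    (hχ : χ ∈ IsManifold.maximalAtlas 𝓘(ℝ, E) ∞ Z) {A : G → Tuples E Z p} {y : G}
    (hA : ContMDiffAt 𝓘(ℝ, G) (𝓘(ℝ, E).prod 𝓘(ℝ, EuclideanSpace ℝ (Fin p) →L[ℝ] E)) ∞ A y)
    (hy : (A y).1 ∈ χ.source) :
    ContDiffAt ℝ ∞ (fun y => (modelDeriv (F := E) (E := E) χ (A y).1).comp (modelTuple (A y))) y := by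
  refine contDiffAt_clm_of_apply fun v => ?_
  have h1 : ContMDiffAt 𝓘(ℝ, G) 𝓘(ℝ, E) ∞ (fun y => (A y).1) y := (contMDiffAt_totalSpace.1 hA).1
  have hv : ContMDiffAt 𝓘(ℝ, G) (𝓘(ℝ, E).prod 𝓘(ℝ, EuclideanSpace ℝ (Fin p))) ∞
      (fun y => (TotalSpace.mk' (EuclideanSpace ℝ (Fin p))
        (E := Bundle.Trivial Z (EuclideanSpace ℝ (Fin p))) (A y).1 v)) y :=
    contMDiffAt_totalSpace.2 ⟨h1, contMDiffAt_const⟩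
  have h2 := ContMDiffAt.clm_bundle_apply (F₁ := EuclideanSpace ℝ (Fin p)) (F₂ := E)
    (E₁ := Bundle.Trivial Z (EuclideanSpace ℝ (Fin p)))
    (E₂ := fun z : Z => TangentSpace 𝓘(ℝ, E) z) (b := fun y => (A y).1)
    (ϕ := fun y => (A y).2) hA hv
  have h3 := (contMDiffAt_tangentMap χ.open_source (contMDiffOn_of_mem_maximalAtlas hχ)
    (v := ⟨(A y).1, (A y).2 v⟩) hy).comp y h2
  have h4 := (contMDiff_snd_tangentBundle_modelSpace E 𝓘(ℝ, E) (n := ∞)).contMDiffAt.comp y h3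
  exact h4.contDiffAt

/-- The converse passage, from coordinates to the bundle: the tangent map of `χ.symm` is smooth, and
the trivialization on the `ℝᵖ` side is the identity. -/
theorem contMDiffAt_tupleAt {χ : OpenPartialHomeomorph Z E}
    (hχ : χ ∈ IsManifold.maximalAtlas 𝓘(ℝ, E) ∞ Z) {L : E → EuclideanSpace ℝ (Fin p) →L[ℝ] E}
    {y : E} (hy : y ∈ χ.target) (hL : ContDiffAt ℝ ∞ L y) :
    ContMDiffAt 𝓘(ℝ, E) (𝓘(ℝ, E).prod 𝓘(ℝ, EuclideanSpace ℝ (Fin p) →L[ℝ] E)) ∞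
      (fun y => tupleAt (χ.symm y) ((modelDeriv (F := E) (E := E) χ.symm y).comp (L y))) y := by
  have hχy := contMDiffAt_symm_of_mem_maximalAtlas hχ hy
  refine (contMDiffAt_hom_bundle _).2 ⟨hχy, ?_⟩
  refine ContDiffAt.contMDiffAt (contDiffAt_clm_of_apply fun v => ?_)
  have h1 : ContMDiffAt 𝓘(ℝ, E) 𝓘(ℝ, E).tangent ∞
      (fun y => (⟨χ.symm y, modelDeriv (F := E) (E := E) χ.symm y (L y v)⟩ : TangentBundle 𝓘(ℝ, E) Z))
      y :=
    (contMDiffAt_tangentMap χ.open_target (contMDiffOn_symm_of_mem_maximalAtlas hχ)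
      (v := ⟨y, L y v⟩) hy).comp y
      (contMDiffAt_tangentBundle_vectorSpace (hL.clm_apply contDiffAt_const))
  refine ((contMDiffAt_totalSpace.1 h1).2.contDiffAt).congr_of_eventuallyEq ?_
  have hbase : ∀ᶠ y' in 𝓝 y, χ.symm y' ∈
      (trivializationAt E (fun z : Z => TangentSpace 𝓘(ℝ, E) z) (χ.symm y)).baseSet :=
    hχy.continuousAt.eventually_mem ((trivializationAt E (fun z : Z => TangentSpace 𝓘(ℝ, E) z)
      (χ.symm y)).open_baseSet.mem_nhds (FiberBundle.mem_baseSet_trivializationAt' _))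
  filter_upwards [hbase] with y' hy'
  have h2 : ((trivializationAt (EuclideanSpace ℝ (Fin p))
      (Bundle.Trivial Z (EuclideanSpace ℝ (Fin p))) (χ.symm y)).symmL ℝ (χ.symm y') v) = v := by
    change (Bundle.Trivial.trivialization Z (EuclideanSpace ℝ (Fin p))).symmL ℝ (χ.symm y') v = v
    rw [Bundle.Trivial.symmL_trivialization]
    rfl
  have h3 := congrFun ((trivializationAt E (fun z : Z => TangentSpace 𝓘(ℝ, E) z)
    (χ.symm y)).coe_linearMapAt_of_mem (R := ℝ) hy')
    (modelDeriv (F := E) (E := E) χ.symm y' (L y' ((trivializationAt (EuclideanSpace ℝ (Fin p))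
      (Bundle.Trivial Z (EuclideanSpace ℝ (Fin p))) (χ.symm y)).symmL ℝ (χ.symm y') v)))
  refine h3.trans ?_
  rw [h2]

variable [IsManifold 𝓘(ℝ, F) ∞ X]

/-- A smooth field of `𝒢`-planes tangent to a submanifold extends to a smooth field of `𝒢`-planes of
the ambient manifold, with a smooth frame. -/
theorem exists_smooth_frame_extension {χ : OpenPartialHomeomorph Z E}
    (hχ : χ ∈ IsManifold.maximalAtlas 𝓘(ℝ, E) ∞ Z) {ψ : OpenPartialHomeomorph X F}
    (hψ : ψ ∈ IsManifold.maximalAtlas 𝓘(ℝ, F) ∞ X) {i : X → Z}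
    (hi : ContMDiff 𝓘(ℝ, F) 𝓘(ℝ, E) ∞ i) {J : F →L[ℝ] E} {Q : E →L[ℝ] F} (hQJ : ∀ a, Q (J a) = a)
    (hJ : ∀ x ∈ ψ.source, i x ∈ χ.source ∧ χ (i x) = J (ψ x)) {x : X} (hx : x ∈ ψ.source)
    {𝒢 : Set (TangentPlane E Z p)} (hρ : HasSmoothFibrewiseRetraction 𝒢)
    {η : X → TangentPlane F X p}
    (hη : ∀ᶠ x' in 𝓝 x, (η x').base = x' ∧ η x' ∈ tangentPlanes i 𝒢)
    (hs : SmoothPlaneFieldAt η x) :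
    ∃ β : E → EuclideanSpace ℝ (Fin p) →L[ℝ] E, ContDiffAt ℝ ∞ β (χ (i x)) ∧
      (∀ᶠ y in 𝓝 (χ (i x)), ∃ ξ ∈ 𝒢,
        IsFrameOf (tupleAt (χ.symm y) ((modelDeriv (F := E) (E := E) χ.symm y).comp (β y))) ξ) ∧
      ∀ᶠ x' in 𝓝 x, LinearMap.range (β (χ (i x'))).toLinearMap = (η x').modelPlane.map
        ((modelDeriv (F := E) (E := E) χ (i x')).comp
          (modelDeriv (F := F) (E := E) i x')).toLinearMap := by
  obtain ⟨N, ρ, hN, h𝒢N, hρ𝒢, hρid, hρbase, hρs⟩ := hρ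
  obtain ⟨A, hA, hAη⟩ := hs
  have hAb : ∀ᶠ x' in 𝓝 x, (A x').1 = x' ∧ Function.Injective (modelTuple (A x')) ∧
      LinearMap.range (modelTuple (A x')).toLinearMap = (η x').modelPlane ∧
      η x' ∈ tangentPlanes i 𝒢 ∧ (η x').base = x' := by
    filter_upwards [hAη, hη] with x' h1 h2
    rw [isFrameOf_iff] at h1
    exact ⟨h1.1.trans h2.1, h1.2.1, h1.2.2, h2.2, h2.1⟩
  have hsymm : ψ.symm (ψ x) = x := ψ.left_inv hx
  let α : F → EuclideanSpace ℝ (Fin p) →L[ℝ] F := fun a =>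
    (modelDeriv (F := F) (E := F) ψ (A (ψ.symm a)).1).comp (modelTuple (A (ψ.symm a)))
  have hα : ContDiffAt ℝ ∞ α (ψ x) := by
    refine contDiffAt_modelTuple hψ (A := fun a => A (ψ.symm a)) ?_ ?_
    · exact ContMDiffAt.comp (ψ x) (by rwa [hsymm])
        (contMDiffAt_symm_of_mem_maximalAtlas hψ (ψ.map_source hx))
    · rw [hsymm, hAb.self_of_nhds.1]
      exact hx
  have hJi : Function.Injective J := Function.LeftInverse.injective hQJ
  set y₀ := χ (i x) with hy₀def
  have hix : i x ∈ χ.source := (hJ x hx).1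
  have hy₀ : y₀ ∈ χ.target := χ.map_source hix
  have hQy₀ : Q y₀ = ψ x := by rw [hy₀def, (hJ x hx).2, hQJ]
  -- The coordinate frame of `η`, extended constantly along the fibres of `Q`. Off the submanifold
  -- its span need not lie in `𝒢`.
  let L : E → EuclideanSpace ℝ (Fin p) →L[ℝ] E := fun y => J.comp (α (Q y))
  have hL : ContDiffAt ℝ ∞ L y₀ :=
    contDiffAt_const.clm_comp (ContDiffAt.comp y₀ (by rwa [hQy₀]) Q.contDiff.contDiffAt)
  let B : E → Tuples E Z p := fun y =>
    tupleAt (χ.symm y) ((modelDeriv (F := E) (E := E) χ.symm y).comp (L y))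
  have hB : ContMDiffAt 𝓘(ℝ, E) (𝓘(ℝ, E).prod 𝓘(ℝ, EuclideanSpace ℝ (Fin p) →L[ℝ] E)) ∞ B y₀ :=
    contMDiffAt_tupleAt hχ hy₀ hL
  have hBx : ∀ᶠ x' in 𝓝 x, ∃ ξ ∈ 𝒢, IsFrameOf (B (χ (i x'))) ξ ∧
      ξ.modelPlane = (η x').modelPlane.map (modelDeriv (F := F) (E := E) i x').toLinearMap ∧
      i x' ∈ χ.source ∧ ξ.base = i x' := by
    filter_upwards [hAb, ψ.open_source.mem_nhds hx] with x' h1 hx'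
    obtain ⟨h2, h3, h4, h5, h6⟩ := h1
    obtain ⟨ξ, hξ, hξb, hξp⟩ := mem_tangentPlanes_iff.1 h5
    rw [h6] at hξb hξp
    have hix' := (hJ x' hx').1
    have hD := modelDeriv_chart_comp_immersion hχ hψ hi hJ hx'
    have hBm : modelTuple (B (χ (i x'))) =
        (modelDeriv (F := F) (E := E) i x').comp (modelTuple (A x')) := by
      ext1 v
      change modelDeriv (F := E) (E := E) χ.symm (χ (i x')) (J (α (Q (χ (i x'))) v)) = _
      have h7 : α (Q (χ (i x'))) v = modelDeriv (F := F) (E := F) ψ x' (modelTuple (A x') v) := by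
        simp only [α, (hJ x' hx').2, hQJ, ψ.left_inv hx', h2, ContinuousLinearMap.comp_apply]
      have h8 := congrArg (fun T : F →L[ℝ] E => T (modelTuple (A x') v)) hD
      simp only [ContinuousLinearMap.comp_apply] at h8
      rw [h7, ← h8, modelDeriv_symm_chart_chart hχ hix']
      rfl
    refine ⟨ξ, hξ, ?_, hξp, hix', hξb⟩
    have hinj := injective_modelDeriv_immersion hχ hψ hi hJi hJ hx'
    rw [isFrameOf_iff, hBm]
    refine ⟨(χ.left_inv hix').trans hξb.symm, hinj.comp h3, ?_⟩
    rw [hξp, ← h4]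
    exact LinearMap.range_comp _ _
  have hBinj : ∀ᶠ y in 𝓝 y₀, IsFrame (B y) ∧ y ∈ χ.target := by
    have h1 : ∀ᶠ a in 𝓝 (ψ x), ψ.symm a ∈ ψ.source ∧ (A (ψ.symm a)).1 = ψ.symm a ∧
        Function.Injective (modelTuple (A (ψ.symm a))) := by
      have h2 : ∀ᶠ x' in 𝓝 x, x' ∈ ψ.source ∧ (A x').1 = x' ∧
          Function.Injective (modelTuple (A x')) := by
        filter_upwards [hAb, ψ.open_source.mem_nhds hx] with x' h3 h4 using ⟨h4, h3.1, h3.2.1⟩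
      have h3 := ψ.continuousAt_symm (ψ.map_source hx)
      rw [ContinuousAt, hsymm] at h3
      exact h3.eventually h2
    have h2 : Filter.Tendsto Q (𝓝 y₀) (𝓝 (ψ x)) := by
      rw [← hQy₀]
      exact Q.continuous.continuousAt
    filter_upwards [χ.open_target.mem_nhds hy₀, h2.eventually h1] with y hy h3
    obtain ⟨h4, h5, h6⟩ := h3
    refine ⟨?_, hy⟩
    have h7 := injective_modelDeriv_chart hψ h4
    rw [← h5] at h7
    exact (injective_modelDeriv_chart_symm hχ hy).comp (hJi.comp (h7.comp h6))
  obtain ⟨ξ₀, hξ₀, hBξ₀, hξ₀p, -, hξ₀b⟩ := hBx.self_of_nhds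
  -- By the quotient topology, the frames of planes in `N` are cut out by an open set of tuples.
  have hBN : ∀ᶠ y in 𝓝 y₀, ∀ ξ, IsFrameOf (B y) ξ → ξ ∈ N := by
    obtain ⟨O, hO, hON⟩ := isOpen_induced_iff.1 (isOpen_coinduced.1 hN)
    have h1 : ∀ (A : Tuples E Z p) (ξ), IsFrameOf A ξ → (A ∈ O ↔ ξ ∈ N) := by
      rintro A ξ ⟨h, rfl⟩
      exact Set.ext_iff.1 hON ⟨A, h⟩
    have h2 : B y₀ ∈ O := (h1 _ _ hBξ₀).2 (h𝒢N hξ₀)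
    filter_upwards [hB.continuousAt.eventually_mem (hO.mem_nhds h2)] with y hy ξ hξ
    exact (h1 _ _ hξ).1 hy
  obtain ⟨R, hR, hRρ⟩ := hρs ξ₀ (h𝒢N hξ₀) (B y₀) hBξ₀
  -- The lift `R` of the retraction moves the spans into `𝒢`, keeping base points. Along the
  -- submanifold the spans are already in `𝒢`, hence unchanged, although the frame itself may
  -- change.
  let β : E → EuclideanSpace ℝ (Fin p) →L[ℝ] E := fun y =>
    (modelDeriv (F := E) (E := E) χ (R (B y)).1).comp (modelTuple (R (B y)))
  have hRB : ∀ᶠ y in 𝓝 y₀, ∀ ξ, IsFrameOf (B y) ξ → IsFrameOf (R (B y)) (ρ ξ) :=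
    hB.continuousAt.eventually hRρ
  have hRbase : ∀ y ξ, IsFrameOf (B y) ξ → ξ ∈ N → IsFrameOf (R (B y)) (ρ ξ) →
      (R (B y)).1 = χ.symm y := by
    intro y ξ h1 h2 h3
    exact (isFrameOf_iff.1 h3).1.trans ((hρbase ξ h2).trans (isFrameOf_iff.1 h1).1.symm)
  refine ⟨β, contDiffAt_modelTuple hχ (hR.comp y₀ hB) ?_, ?_, ?_⟩
  · rw [hRbase y₀ ξ₀ hBξ₀ (h𝒢N hξ₀) (hRB.self_of_nhds _ hBξ₀)]
    exact χ.map_target hy₀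
  · filter_upwards [hBinj, hBN, hRB] with y h1 h2 h3
    have h4 : IsFrameOf (B y) (planeOf ⟨B y, h1.1⟩) := ⟨h1.1, rfl⟩
    have h5 := h2 _ h4
    have h6 := h3 _ h4
    have h7 := hRbase y _ h4 h5 h6
    refine ⟨_, hρ𝒢 _ h5, isFrameOf_tupleAt_of_eq h7 ?_ h6⟩
    ext1 v
    have h8 := modelDeriv_symm_chart_chart hχ (χ.map_target h1.2) (modelTuple (R (B y)) v)
    rw [χ.right_inv h1.2] at h8
    simp only [β, h7, ContinuousLinearMap.comp_apply]
    exact h8.symm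
  · have hcont : ContinuousAt (fun x' => χ (i x')) x :=
      (χ.continuousAt hix).comp hi.continuous.continuousAt
    filter_upwards [hBx, hcont.eventually hRB] with x' h1 h2
    obtain ⟨ξ, hξ, hBξ, hξp, hix', hξb⟩ := h1
    have h3 := h2 _ hBξ
    have h4 := hRbase _ _ hBξ (h𝒢N hξ) h3
    rw [hρid ξ hξ, isFrameOf_iff] at h3
    have h5 : (R (B (χ (i x')))).1 = i x' := h4.trans (χ.left_inv hix')
    have h6 : β (χ (i x')) = (modelDeriv (F := E) (E := E) χ (i x')).comp
        (modelTuple (R (B (χ (i x'))))) := by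
      simp only [β, h5]
    rw [h6]
    refine (LinearMap.range_comp _ _).trans ?_
    rw [h3.2.2, hξp, ← Submodule.map_comp]
    rfl

end Frames

/-! ### Adapted charts and transfer of the hypotheses to coordinates -/

section Main

variable {E : Type*} [NormedAddCommGroup E] [NormedSpace ℝ E]
  {Z : Type*} [TopologicalSpace Z] [ChartedSpace E Z]
  {F : Type*} [NormedAddCommGroup F] [NormedSpace ℝ F]
  {X : Type*} [TopologicalSpace X] [ChartedSpace F X] {p : ℕ}

/-- Charts in which an immersion is a linear inclusion `J`, with a linear retraction `Q` of `J` and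
linear equations `P` of its image. -/
theorem exists_immersion_charts [FiniteDimensional ℝ E] {i : X → Z}
    (hi : IsImmersion 𝓘(ℝ, F) 𝓘(ℝ, E) ∞ i) (x : X) :
    ∃ (χ : OpenPartialHomeomorph Z E) (ψ : OpenPartialHomeomorph X F) (J : F →L[ℝ] E)
      (Q : E →L[ℝ] F) (m : ℕ) (P : E →L[ℝ] EuclideanSpace ℝ (Fin m)) (C : ℝ),
      χ ∈ IsManifold.maximalAtlas 𝓘(ℝ, E) ∞ Z ∧ ψ ∈ IsManifold.maximalAtlas 𝓘(ℝ, F) ∞ X ∧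
      x ∈ ψ.source ∧ (∀ x' ∈ ψ.source, i x' ∈ χ.source ∧ χ (i x') = J (ψ x')) ∧
      (∀ a, Q (J a) = a) ∧ (∀ a, P (J a) = 0) ∧ ∀ y, ‖y - J (Q y)‖ ≤ C * ‖P y‖ := by
  have h := hi.isImmersionAt x
  let K := h.complement
  have : FiniteDimensional ℝ (F × K) := h.equiv.symm.toLinearEquiv.finiteDimensional
  have : FiniteDimensional ℝ K :=
    FiniteDimensional.of_injective (LinearMap.inr ℝ F K) LinearMap.inr_injective
  -- `T` inverts `P` on the complement of the range of `J`: `y - J (Q y) = T (P y)`, whence the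
  -- constant `‖T‖`.
  let T : EuclideanSpace ℝ (Fin (finrank ℝ K)) →L[ℝ] E :=
    (h.equiv : (F × K) →L[ℝ] E).comp ((ContinuousLinearMap.inr ℝ F K).comp
      ((toEuclidean (E := K)).symm : EuclideanSpace ℝ (Fin (finrank ℝ K)) →L[ℝ] K))
  let P : E →L[ℝ] EuclideanSpace ℝ (Fin (finrank ℝ K)) :=
    ((toEuclidean (E := K)) : K →L[ℝ] EuclideanSpace ℝ (Fin (finrank ℝ K))).comp
      ((ContinuousLinearMap.snd ℝ F K).comp (h.equiv.symm : E →L[ℝ] F × K))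
  let J : F →L[ℝ] E := (h.equiv : (F × K) →L[ℝ] E).comp (ContinuousLinearMap.inl ℝ F K)
  let Q : E →L[ℝ] F := (ContinuousLinearMap.fst ℝ F K).comp (h.equiv.symm : E →L[ℝ] F × K)
  refine ⟨h.codChart, h.domChart, J, Q, finrank ℝ K, P, ‖T‖, h.codChart_mem_maximalAtlas,
    h.domChart_mem_maximalAtlas, h.mem_domChart_source,
    fun x' hx' => ⟨h.source_subset_preimage_source hx', ?_⟩, fun a => by simp [J, Q],
    fun a => by simp [J, P], fun y => ?_⟩
  · have h1 := h.writtenInCharts ((h.domChart.extend 𝓘(ℝ, F)).map_source (x := x')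
      (by simpa using hx'))
    simpa [h.domChart.left_inv hx', J] using h1
  · have h1 : y - J (Q y) = T (P y) := by
      apply h.equiv.symm.injective
      simp [J, Q, T, P, Prod.ext_iff]
    rw [h1]
    exact T.le_opNorm _

theorem frameTrace_congr {h : E → E →L[ℝ] E →L[ℝ] ℝ} {β : E → Fin p → E} {f f' : E → ℝ} {y : E}
    (hf : f =ᶠ[𝓝 y] f') : frameTrace h β f y = frameTrace h β f' y := by
  simp only [frameTrace, localHessian_congr Filter.EventuallyEq.rfl hf]

theorem hessian_congr (g : BilinearField E Z) {φ φ' : Z → ℝ} {z : Z} (h : φ =ᶠ[𝓝 z] φ')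
    (v w : TangentSpace 𝓘(ℝ, E) z) : hessian g φ z v w = hessian g φ' z v w := by
  refine localHessian_congr Filter.EventuallyEq.rfl ?_ _ _
  have h1 := (chartAt E z).continuousAt_symm ((chartAt E z).map_source (mem_chart_source E z))
  rw [ContinuousAt, (chartAt E z).left_inv (mem_chart_source E z)] at h1
  exact h1.eventually h

theorem hessian_const (g : BilinearField E Z) (c : ℝ) (z : Z) (v w : TangentSpace 𝓘(ℝ, E) z) :
    hessian g (fun _ => c) z v w = 0 :=
  localHessian_const _ c _ _ _

theorem span_range_clm_apply_single (L : EuclideanSpace ℝ (Fin p) →L[ℝ] E) :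
    Submodule.span ℝ (Set.range fun j => L (EuclideanSpace.single j 1)) =
      LinearMap.range L.toLinearMap := by
  have h1 := (EuclideanSpace.basisFun (Fin p) ℝ).toBasis.span_eq
  have h2 := congrArg (Submodule.map L.toLinearMap) h1
  rw [Submodule.map_span, ← Set.range_comp, Submodule.map_top] at h2
  rw [← h2]
  congr 2
  ext j
  simp

/-- The frame of tangent vectors given by a field of tuples. -/
noncomputable def frameOf (β : E → EuclideanSpace ℝ (Fin p) →L[ℝ] E) (y : E) (j : Fin p) : E :=
  β y (EuclideanSpace.single j 1)

variable [IsManifold 𝓘(ℝ, E) ∞ Z]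
  (g : ContMDiffRiemannianMetric 𝓘(ℝ, E) ∞ E (fun z : Z => TangentSpace 𝓘(ℝ, E) z))

theorem isInnerProduct_modelForm
    {i : X → Z} {x : X} (hinj : Function.Injective (modelDeriv (F := F) (E := E) i x)) :
    IsInnerProduct (modelForm (pullbackMetric (F := F) i g.inner) x) where
  symm _ _ := g.symm _ _ _
  pos _ hv := g.pos _ _ fun h => hv (hinj (h.trans (map_zero _).symm))

theorem modelForm_eq_localMetric {χ : OpenPartialHomeomorph Z E}
    (hχ : χ ∈ IsManifold.maximalAtlas 𝓘(ℝ, E) ∞ Z) {z : Z} (hz : z ∈ χ.source) (v w : E) :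
    localMetric g.inner χ.symm (χ z) (modelDeriv (F := E) (E := E) χ z v)
      (modelDeriv (F := E) (E := E) χ z w) = modelForm g.inner z v w := by
  rw [localMetric_apply, modelDeriv_symm_chart_chart hχ hz, modelDeriv_symm_chart_chart hχ hz,
    χ.left_inv hz]

variable [FiniteDimensional ℝ E]

/-- The pulled-back function `f ∘ χ` is tested on an orthonormal basis of the span of `β y`, carried
to `Z` by the differential of `χ.symm`. Values of `χ` off its source are harmless, as test functions
are local. -/
theorem frameTrace_nonneg_of_isPlurisubharmonic {χ : OpenPartialHomeomorph Z E}
    (hχ : χ ∈ IsManifold.maximalAtlas 𝓘(ℝ, E) ∞ Z) {𝒢 : Set (TangentPlane E Z p)} {u : Z → EReal}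
    (hu : IsPlurisubharmonic g.inner 𝒢 u) {β : E → EuclideanSpace ℝ (Fin p) →L[ℝ] E} {y : E}
    (hy : y ∈ χ.target) {ξ : TangentPlane E Z p} (hξ : ξ ∈ 𝒢)
    (hβ : IsFrameOf (tupleAt (χ.symm y) ((modelDeriv (F := E) (E := E) χ.symm y).comp (β y))) ξ)
    {f : E → ℝ} (hf : ContDiffAt ℝ 2 f y) (huf : ∀ᶠ y' in 𝓝 y, u (χ.symm y') ≤ f y')
    (hufy : u (χ.symm y) = f y) :
    0 ≤ frameTrace (localMetric g.inner χ.symm) (frameOf β) f y := by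
  obtain ⟨hfr, rfl⟩ := hβ
  have hz := χ.map_target hy
  have hyz : χ (χ.symm y) = y := χ.right_inv hy
  have hinj : Function.Injective (β y) := Function.Injective.of_comp 
    (f := modelDeriv (F := E) (E := E) χ.symm y) hfr
  obtain ⟨e, he, hspan⟩ := (isInnerProduct_localMetric_chart g hχ hy).exists_orthonormal (p := p)
    (LinearMap.range (β y).toLinearMap)
    ((LinearMap.finrank_range_of_inj hinj).trans finrank_euclideanSpace_fin)
  have hev : ∀ᶠ z in 𝓝 (χ.symm y), χ.symm (χ z) = z :=
    Filter.eventually_of_mem (χ.open_source.mem_nhds hz) fun z hz => χ.left_inv hz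
  have hφ : ContMDiffAt 𝓘(ℝ, E) 𝓘(ℝ, ℝ) 2 (f ∘ χ) (χ.symm y) :=
    ContMDiffAt.comp _ (by rw [hyz]; exact hf.contMDiffAt)
      ((contMDiffAt_of_mem_maximalAtlas hχ hz).of_le ENat.LEInfty.out)
  have htest : IsTestFunction (E := E) u (χ.symm y) (f ∘ χ) := by
    refine ⟨hφ, ?_, by simp [hyz, hufy]⟩
    have h1 := χ.continuousAt hz
    rw [ContinuousAt, hyz] at h1
    filter_upwards [h1.eventually huf, hev] with z h2 h3
    rwa [h3] at h2
  have hes : ∀ j, modelDeriv (F := E) (E := E) χ (χ.symm y)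
      (modelDeriv (F := E) (E := E) χ.symm y (e j)) = e j := fun j =>
    modelDeriv_chart_symm_chart hχ hy (e j)
  have h1 := hu.2.2 _ hξ (f ∘ χ) htest (fun j => modelDeriv (F := E) (E := E) χ.symm y (e j))
    ⟨he, by
      refine Eq.trans ?_ (LinearMap.range_comp (β y).toLinearMap
        (modelDeriv (F := E) (E := E) χ.symm y).toLinearMap).symm
      rw [← hspan, Submodule.map_span, ← Set.range_comp]
      rfl⟩
  have h2 : ∑ j, localHessian (localMetric g.inner χ.symm) f y (e j) (e j) =
      frameTrace (localMetric g.inner χ.symm) (frameOf β) f y :=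
    sum_localHessian_eq_frameTrace he
      (hspan.trans (span_range_clm_apply_single (β y)).symm) f
  rw [← h2]
  refine h1.trans_eq (Finset.sum_congr rfl fun j _ => ?_)
  refine (hessian_eq_localHessian g hχ hz hφ _ _).trans ?_
  rw [hes, hyz]
  refine localHessian_congr Filter.EventuallyEq.rfl ?_ _ _
  filter_upwards [χ.open_target.mem_nhds hy] with y' hy'
  simp [χ.right_inv hy']

variable [FiniteDimensional ℝ F] [IsManifold 𝓘(ℝ, F) ∞ X]

/-- On a flat submanifold, the trace of the Hessian of the restriction of a function over a
`𝒢`-plane is computed in the ambient manifold, from any frame. -/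
theorem sum_hessian_eq_frameTrace {χ : OpenPartialHomeomorph Z E}
    (hχ : χ ∈ IsManifold.maximalAtlas 𝓘(ℝ, E) ∞ Z) {i : X → Z}
    (hi : ContMDiff 𝓘(ℝ, F) 𝓘(ℝ, E) ∞ i) {𝒢 : Set (TangentPlane E Z p)}
    (hflat : IsFlat (F := F) g.inner i 𝒢) {ζ : TangentPlane F X p} (hζ : ζ ∈ tangentPlanes i 𝒢)
    (hζχ : i ζ.base ∈ χ.source)
    (hinj : Function.Injective (modelDeriv (F := F) (E := E) i ζ.base))
    {β : E → EuclideanSpace ℝ (Fin p) →L[ℝ] E}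
    (hβ : LinearMap.range (β (χ (i ζ.base))).toLinearMap = ζ.modelPlane.map
      ((modelDeriv (F := E) (E := E) χ (i ζ.base)).comp
        (modelDeriv (F := F) (E := E) i ζ.base)).toLinearMap)
    {e : Fin p → F} (he : IsOrthonormalBasisOf (pullbackMetric (F := F) i g.inner) ζ e) :
    IsUnit (gram (localMetric g.inner χ.symm (χ (i ζ.base))) (frameOf β (χ (i ζ.base)))).det ∧
    ∀ {f : Z → ℝ}, ContMDiffAt 𝓘(ℝ, E) 𝓘(ℝ, ℝ) 2 f (i ζ.base) →
      ∑ j, hessian (pullbackMetric (F := F) i g.inner) (f ∘ i) ζ.base (e j) (e j) =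
        frameTrace (localMetric g.inner χ.symm) (frameOf β) (f ∘ χ.symm) (χ (i ζ.base)) := by
  -- Orthonormal for the ambient metric, because `e` is so for the induced one.
  let e' : Fin p → E := fun j => modelDeriv (F := E) (E := E) χ (i ζ.base)
    (modelDeriv (F := F) (E := E) i ζ.base (e j))
  have h1 : ∀ j k, localMetric g.inner χ.symm (χ (i ζ.base)) (e' j) (e' k) =
      if j = k then 1 else 0 := fun j k =>
    (modelForm_eq_localMetric g hχ hζχ _ _).trans (he.1 j k)
  have h2 : Submodule.span ℝ (Set.range e') =
      Submodule.span ℝ (Set.range (frameOf β (χ (i ζ.base)))) := by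
    refine Eq.trans ?_ (span_range_clm_apply_single (β (χ (i ζ.base)))).symm
    have h3 : Submodule.span ℝ (Set.range e) = ζ.modelPlane := he.2
    rw [hβ, ← h3, Submodule.map_span, ← Set.range_comp]
    rfl
  refine ⟨(exists_gram_inv_sum_eq h1 h2).1, fun {f} hf => ?_⟩
  refine (sum_hessian_comp g hi hinj (hflat.2 ζ hζ e he) hf).trans ?_
  rw [← sum_localHessian_eq_frameTrace h1 h2]
  exact Finset.sum_congr rfl fun j _ => hessian_eq_localHessian g hχ hζχ hf _ _

end Main

end GeometricRestriction

/-! ### The restriction theorem -/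

open GeometricRestriction in
theorem theorem8p2
    {E : Type*} [NormedAddCommGroup E] [NormedSpace ℝ E] [FiniteDimensional ℝ E]
    {Z : Type*} [TopologicalSpace Z] [ChartedSpace E Z] [IsManifold 𝓘(ℝ, E) ∞ Z]
    {F : Type*} [NormedAddCommGroup F] [NormedSpace ℝ F] [FiniteDimensional ℝ F]
    {X : Type*} [TopologicalSpace X] [ChartedSpace F X] [IsManifold 𝓘(ℝ, F) ∞ X]
    (g : ContMDiffRiemannianMetric 𝓘(ℝ, E) ∞ E (fun z : Z => TangentSpace 𝓘(ℝ, E) z))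
    (p : ℕ) (𝒢 : Set (GeometricRestriction.TangentPlane E Z p))
    (h𝒢 : IsClosed 𝒢) (hρ : GeometricRestriction.HasSmoothFibrewiseRetraction 𝒢)
    (i : X → Z) (hi : IsImmersion 𝓘(ℝ, F) 𝓘(ℝ, E) ∞ i) (hinj : Function.Injective i)
    (hdim : p ≤ Module.finrank ℝ F)
    (hflat : GeometricRestriction.IsFlat (F := F) g.inner i 𝒢)
    (u : Z → EReal) (hu : GeometricRestriction.IsPlurisubharmonic g.inner 𝒢 u) :
    GeometricRestriction.IsPlurisubharmonic
      (GeometricRestriction.pullbackMetric (F := F) i g.inner)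
      (GeometricRestriction.tangentPlanes (F := F) i 𝒢) (u ∘ i) := by
  have hsm : ContMDiff 𝓘(ℝ, F) 𝓘(ℝ, E) ∞ i := hi.contMDiff
  refine ⟨hu.1.comp hsm.continuous, fun x => hu.2.1 _, ?_⟩
  intro ζ₀ hζ₀ φ hφ e he
  obtain ⟨χ, ψ, J, Q, m, P, C, hχ, hψ, hx, hJ, hQJ, hPJ, hC⟩ := exists_immersion_charts hi ζ₀.base
  obtain ⟨U, η, hU, hxU, hη₀, hη⟩ := hflat.1 ζ₀ hζ₀
  have hJi : Function.Injective J := Function.LeftInverse.injective hQJ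
  have hUn : ∀ᶠ x in 𝓝 ζ₀.base, x ∈ U := hU.mem_nhds hxU
  obtain ⟨β, hβ, hβ𝒢, hβη⟩ := exists_smooth_frame_extension hχ hψ hsm hQJ hJ hx hρ
    (hUn.mono fun x hx => ⟨(hη x hx).1, (hη x hx).2.1⟩) (hη _ hxU).2.2
  have hDi : ∀ x ∈ ψ.source, Function.Injective (modelDeriv (F := F) (E := E) i x) := fun x hx =>
    injective_modelDeriv_immersion hχ hψ hsm hJi hJ hx
  have hβζ := hβη.self_of_nhds
  rw [hη₀] at hβζ
  set y₀ := χ (i ζ₀.base) with hy₀def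
  have hix := (hJ _ hx).1
  have hy₀ : y₀ ∈ χ.target := χ.map_source hix
  have hy₀J : y₀ = J (ψ ζ₀.base) := (hJ _ hx).2
  have hQy₀ : Q y₀ = ψ ζ₀.base := by rw [hy₀J, hQJ]
  have hsymm : ψ.symm (ψ ζ₀.base) = ζ₀.base := ψ.left_inv hx
  -- `φ` extended constantly along the fibres of `Q`; it dominates `u` near `y₀` on the image of the
  -- submanifold.
  let f : E → ℝ := (φ ∘ ψ.symm) ∘ Q
  have hf : ContDiffAt ℝ 2 f y₀ := by
    refine ContDiffAt.comp y₀ ?_ Q.contDiff.contDiffAt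
    rw [hQy₀]
    exact contDiffAt_comp_chart_symm hψ hx (n := 2) hφ.1
  have hfχ : ContMDiffAt 𝓘(ℝ, E) 𝓘(ℝ, ℝ) 2 (f ∘ χ) (i ζ₀.base) :=
    ContMDiffAt.comp _ hf.contMDiffAt
      ((contMDiffAt_of_mem_maximalAtlas hχ hix).of_le ENat.LEInfty.out)
  have hfφ : φ =ᶠ[𝓝 ζ₀.base] (f ∘ χ) ∘ i := by
    filter_upwards [ψ.open_source.mem_nhds hx] with x hx
    simp [f, (hJ x hx).2, hQJ, ψ.left_inv hx]
  have hχsymm : ∀ {k : E → ℝ} {y}, y ∈ χ.target → (k ∘ χ) ∘ χ.symm =ᶠ[𝓝 y] k := by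
    intro k y hy
    filter_upwards [χ.open_target.mem_nhds hy] with y' hy'
    simp [χ.right_inv hy']
  obtain ⟨hdet, htr⟩ := sum_hessian_eq_frameTrace g hχ hsm hflat hζ₀ hix (hDi _ hx) hβζ he
  have hgoal := htr hfχ
  rw [frameTrace_congr (hχsymm hy₀)] at hgoal
  rw [Finset.sum_congr rfl fun j _ => hessian_congr _ hfφ (e j) (e j)]
  refine le_of_le_of_eq ?_ hgoal.symm
  -- points of the submanifold near `x` have the coordinates `J (Q y)`, `y` near `y₀`
  have hnear : ∀ q : X → Prop, (∀ᶠ x in 𝓝 ζ₀.base, q x) →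
      ∀ᶠ y in 𝓝 y₀, ∃ x ∈ ψ.source, χ (i x) = J (Q y) ∧ x = ψ.symm (Q y) ∧ q x := by
    intro q hq
    have h1 : Filter.Tendsto (fun y => ψ.symm (Q y)) (𝓝 y₀) (𝓝 ζ₀.base) := by
      have h2 : Filter.Tendsto Q (𝓝 y₀) (𝓝 (ψ ζ₀.base)) := hQy₀ ▸ Q.continuous.continuousAt
      have h3 := ψ.continuousAt_symm (ψ.map_source hx)
      rw [ContinuousAt, hsymm] at h3
      exact h3.comp h2
    have h4 : ∀ᶠ y in 𝓝 y₀, Q y ∈ ψ.target := by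
      refine Q.continuous.continuousAt.eventually_mem (ψ.open_target.mem_nhds ?_)
      rw [hQy₀]
      exact ψ.map_source hx
    filter_upwards [h1.eventually hq, h4] with y hy1 hy2
    have h5 := ψ.map_target hy2
    exact ⟨_, h5, by rw [(hJ _ h5).2, ψ.right_inv hy2], rfl, hy1⟩
  have hhy₀ := contDiffAt_localMetric_chart g hχ hy₀
  have hplanes : ∀ᶠ x in 𝓝 ζ₀.base, ∃ ζ ∈ tangentPlanes (F := F) i 𝒢, ζ.base = x ∧
      LinearMap.range (β (χ (i x))).toLinearMap = ζ.modelPlane.map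
        ((modelDeriv (F := E) (E := E) χ (i x)).comp
          (modelDeriv (F := F) (E := E) i x)).toLinearMap := by
    filter_upwards [hβη, hUn] with x h1 h2
    exact ⟨η x, (hη x h2).2.1, (hη x h2).1, h1⟩
  refine frameTrace_nonneg (P := P) (Q := J.comp Q) (C := C) (u := u ∘ χ.symm)
    (hhy₀.of_le ENat.LEInfty.out) (isInnerProduct_localMetric_chart g hχ hy₀).isInvertible
    (fun j => (hβ.of_le (by simp)).clm_apply contDiffAt_const) hdet
    (by rw [ContinuousLinearMap.comp_apply, hQy₀, ← hy₀J]) hC (by rw [hy₀J, hPJ]) ?_ ?_ ?_ (fun y => hu.2.1 _) ?_ hf ?_ ?_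
  · filter_upwards [hnear _ hplanes] with y hy j
    obtain ⟨x, hxψ, hxy, -, ζ, hζ, rfl, hζβ⟩ := hy
    rw [modelDeriv_chart_comp_immersion hχ hψ hsm hJ hxψ, hxy] at hζβ
    have h1 : frameOf β (J (Q y)) j ∈ LinearMap.range (β (J (Q y))).toLinearMap := ⟨_, rfl⟩
    rw [hζβ] at h1
    obtain ⟨v, -, hv⟩ := h1
    exact (congrArg P hv.symm).trans (hPJ _)
  · filter_upwards [hnear _ hplanes] with y hy ℓ
    obtain ⟨x, hxψ, hxy, -, ζ, hζ, rfl, hζβ⟩ := hy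
    obtain ⟨e', he', hspan⟩ := (isInnerProduct_modelForm g (hDi _ hxψ)).exists_orthonormal
      ζ.modelPlane ζ.finrank_eq
    have hiζ := (hJ _ hxψ).1
    have hℓ : ContMDiffAt 𝓘(ℝ, E) 𝓘(ℝ, ℝ) 2 ((ℓ ∘L P) ∘ χ) (i ζ.base) :=
      ContMDiffAt.comp _ (ContinuousLinearMap.contDiff _).contDiffAt.contMDiffAt
        ((contMDiffAt_of_mem_maximalAtlas hχ hiζ).of_le ENat.LEInfty.out)
    have h1 := (sum_hessian_eq_frameTrace g hχ hsm hflat hζ hiζ (hDi _ hxψ) hζβ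
      (e := e') ⟨he', hspan⟩).2 hℓ
    -- The equations of the submanifold restrict to zero on it, so their intrinsic Hessians vanish;
    -- by flatness so do their ambient traces.
    have h2 : ((ℓ ∘L P) ∘ χ) ∘ i =ᶠ[𝓝 ζ.base] fun _ => 0 := by
      filter_upwards [ψ.open_source.mem_nhds hxψ] with x' hx'
      simp [(hJ x' hx').2, hPJ]
    rw [Finset.sum_congr rfl fun j _ => (hessian_congr _ h2 (e' j) (e' j)).trans
      (hessian_const _ _ _ _ _), Finset.sum_const_zero,
      frameTrace_congr (hχsymm (χ.map_source hiζ)), hxy] at h1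
    exact h1.symm
  · filter_upwards [χ.open_target.mem_nhds hy₀] with y hy
    exact (hu.1 _).comp (χ.continuousAt_symm hy)
  · filter_upwards [χ.open_target.mem_nhds hy₀, hβ𝒢] with y hy h1 k hk huk hky
    obtain ⟨ξ, hξ, hβξ⟩ := h1
    exact frameTrace_nonneg_of_isPlurisubharmonic g hχ hu hy hξ hβξ hk huk hky
  · filter_upwards [hnear _ hφ.2.1, χ.open_target.mem_nhds hy₀] with y h1 hy hPy
    obtain ⟨x, hxψ, hxy, hxQ, hux⟩ := h1
    -- The estimate `hC` forces every zero of `P` into the range of `J`.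
    have h2 : y = J (Q y) := by
      have := hC y
      rw [hPy, norm_zero, mul_zero] at this
      exact sub_eq_zero.1 (norm_le_zero_iff.1 this)
    have h3 : χ.symm y = i x := by rw [h2, ← hxy, χ.left_inv (hJ x hxψ).1]
    simp only [Function.comp_apply, h3, f, ← hxQ]
    exact hux
  · have h1 : χ.symm y₀ = i ζ₀.base := χ.left_inv hix
    simp only [Function.comp_apply, h1, f, hQy₀, hsymm]
    exact hφ.2.2
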